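/- Let $n\ge 1$ and let $\mathcal A=\{\alpha_1,\dots,\alpha_{n+3}\}\subset\mathbb R^n$ be a near-circuit, i.e. a set of $n+3$ distinct points not contained in an affine hyperplane. Let $\widehat{\mathcal A}\in\mathbb R^{(n+1)\times(n+3)}$ be the matrix with columns $(1,\alpha_i)^\top$, let $B\in\mathbb R^{(n+3)\times 2}$ be a Gale dual matrix of $\mathcal A$ (its columns form a basis of $\ker\widehat{\mathcal A}$), and let $\varepsilon\in\{\pm1\}^{n+3}$. Let $\nabla_{\mathcal A,\varepsilon}$ be the set of $c\in\mathbb R^{n+3}$ with $\operatorname{sign}(c)=\varepsilon$ for which $f_c(x)=\sum_i c_i e^{\alpha_i\cdot x}$ has a real zero at which all its first partial derivatives vanish. The signed reduced $\mathcal A$-discriminant curve is $\Gamma=\{B^\top\mathrm{Log}|c| : c\in\nabla_{\mathcal A,\varepsilon}\}\subset\mathbb R^2$. It is the image of the cone $C=\{\lambda\in\mathbb R^2:\operatorname{sign}(B\lambda)=\varepsilon\}$ under $\xi(\lambda)=B^\top\mathrm{Log}|B\lambda|$, and $\xi$ is constant along rays; a cusp of $\Gamma$ is a ray of $C$ along which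 the differential of $\xi$ vanishes. A chamber is a connected component of $\mathbb R^2\setminus\Gamma$; it is called inner if it is bounded and outer if it is unbounded. The depth of a chamber is the minimum number of intersections with $\Gamma$ of a path that runs from a point of the chamber to a point of an outer chamber and meets $\Gamma$ transversally (in particular not at cusps), where an intersection at a point lying on several branches of $\Gamma$ is counted once for each branch. Two distinct chambers are adjacent if their common boundary contains an arc of $\Gamma$. Suppose that $\Gamma$ has exactly $m$ cusps. Then: 1. Every chamber has depth at most $\lfloor m/2\rfloor$. 2. If $m\in\{2,3\}$, then every inner chamber has depth $1$. 3. If $m=4$, then every chamber has depth at most $2$, and every chamber adjacent to a chamber of depth $2$ has depth $1$ (in particular, no two chambers of depth $2$ are adjacent). -/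

import Mathlib

open scoped Matrix

namespace NearCircuit

noncomputable section

/-- A family of exponent vectors is a near-circuit if it consists of `n + 3` distinct points
of `ℝⁿ` that do not lie in an affine hyperplane. -/
def IsNearCircuit {n : ℕ} (A : Fin (n + 3) → Fin n → ℝ) : Prop :=
  Function.Injective A ∧ affineSpan ℝ (Set.range A) = ⊤

/-- The matrix `Â` with top row `(1, …, 1)` and the exponent vectors below it as columns. -/
def hat {n : ℕ} (A : Fin (n + 3) → Fin n → ℝ) : Matrix (Fin (n + 1)) (Fin (n + 3)) ℝ :=
  Matrix.of fun r i => (Fin.cons 1 (A i) : Fin (n + 1) → ℝ) r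

/-- `B` is a Gale dual matrix of `A`: its columns form a basis of `ker Â`. -/
def IsGaleDual {n : ℕ} (A : Fin (n + 3) → Fin n → ℝ) (B : Matrix (Fin (n + 3)) (Fin 2) ℝ) :
    Prop :=
  LinearIndependent ℝ (fun j : Fin 2 => B.col j) ∧
    Submodule.span ℝ (Set.range fun j : Fin 2 => B.col j) = LinearMap.ker (hat A).mulVecLin

/-- The exponential sum `f_c(x) = ∑ᵢ cᵢ exp(αᵢ · x)`. -/
def expSum {n : ℕ} (A : Fin (n + 3) → Fin n → ℝ) (c : Fin (n + 3) → ℝ) (x : Fin n → ℝ) : ℝ :=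
  ∑ i, c i * Real.exp (A i ⬝ᵥ x)

/-- `x` is a singular zero of `f`: `f` and all its first partial derivatives vanish at `x`. -/
def IsSingularZero {n : ℕ} (f : (Fin n → ℝ) → ℝ) (x : Fin n → ℝ) : Prop :=
  f x = 0 ∧ ∀ j, fderiv ℝ f x (Pi.single j 1) = 0

/-- The open orthant of sign vector `ε`. -/
def orthant {N : ℕ} (ε : Fin N → SignType) : Set (Fin N → ℝ) :=
  {c | ∀ i, SignType.sign (c i) = ε i}

/-- The signed `A`-discriminant variety. -/
def discriminant {n : ℕ} (A : Fin (n + 3) → Fin n → ℝ) (ε : Fin (n + 3) → SignType) :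
    Set (Fin (n + 3) → ℝ) :=
  {c | c ∈ orthant ε ∧ ∃ x, IsSingularZero (expSum A c) x}

/-- The map `c ↦ Bᵀ Log|c|`. -/
def logMap {N : ℕ} (B : Matrix (Fin N) (Fin 2) ℝ) (c : Fin N → ℝ) : Fin 2 → ℝ :=
  Bᵀ *ᵥ fun i => Real.log |c i|

/-- The signed reduced `A`-discriminant curve `Γ_ε(A, B) = Bᵀ Log|∇_{A,ε}|`. -/
def curve {n : ℕ} (A : Fin (n + 3) → Fin n → ℝ) (B : Matrix (Fin (n + 3)) (Fin 2) ℝ)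
    (ε : Fin (n + 3) → SignType) : Set (Fin 2 → ℝ) :=
  logMap B '' discriminant A ε

/-- The cone `C_{B,ε}` of parameters `l` with `B l` in the orthant of `ε`. -/
def cone {N : ℕ} (B : Matrix (Fin N) (Fin 2) ℝ) (ε : Fin N → SignType) : Set (Fin 2 → ℝ) :=
  {l | B *ᵥ l ∈ orthant ε}

/-- The Horn–Kapranov map `ξ(l) = Bᵀ Log|B l|`. -/
def xi {N : ℕ} (B : Matrix (Fin N) (Fin 2) ℝ) (l : Fin 2 → ℝ) : Fin 2 → ℝ :=
  logMap B (B *ᵥ l)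

/-- For a Gale dual matrix the Horn–Kapranov map is constant along rays, so the curve is really
parametrized by the rays of the cone. Every ray of the cone contains exactly one point `l` with
`∑ᵢ |(B l)ᵢ| = 1`, which we use to represent it; these points form an open line segment. -/
def params {N : ℕ} (B : Matrix (Fin N) (Fin 2) ℝ) (ε : Fin N → SignType) : Set (Fin 2 → ℝ) :=
  {l | l ∈ cone B ε ∧ ∑ i, |(B *ᵥ l) i| = 1}

/-- The cusps, as parameters (one for each ray): the points where the differential of `ξ`
vanishes. The derivative of `ξ` along the ray is always zero, so this says that the derivative
of `ξ` in any one direction transverse to the ray is zero. -/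
def cusps {N : ℕ} (B : Matrix (Fin N) (Fin 2) ℝ) (ε : Fin N → SignType) : Set (Fin 2 → ℝ) :=
  {l | l ∈ params B ε ∧ fderiv ℝ (xi B) l = 0}

/-- A chamber is a connected component of the complement of the curve. -/
def IsChamber (Γ C : Set (Fin 2 → ℝ)) : Prop :=
  ∃ p ∈ Γᶜ, C = connectedComponentIn Γᶜ p

/-- Outer chambers are the unbounded ones. -/
def IsOuter (Γ C : Set (Fin 2 → ℝ)) : Prop :=
  IsChamber Γ C ∧ ¬ Bornology.IsBounded C

/-- Inner chambers are the bounded ones. -/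
def IsInner (Γ C : Set (Fin 2 → ℝ)) : Prop :=
  IsChamber Γ C ∧ Bornology.IsBounded C

/-- The intersections of a path `a : [0, 1] → ℝ²` with the parametrized curve: pairs of a time and
a curve parameter with the same image. A passage through a point where two branches of the
curve meet thus counts once for each branch. -/
def crossings {N : ℕ} (B : Matrix (Fin N) (Fin 2) ℝ) (ε : Fin N → SignType)
    (a : ℝ → Fin 2 → ℝ) : Set (ℝ × (Fin 2 → ℝ)) :=
  {q | q.1 ∈ Set.Icc (0 : ℝ) 1 ∧ q.2 ∈ params B ε ∧ a q.1 = xi B q.2}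

/-- A path meets the curve transversally if at each intersection it has a velocity vector which
together with the image of the differential of `ξ` spans the plane. In particular it
does not pass through cusps. -/
def IsTransversalPath {N : ℕ} (B : Matrix (Fin N) (Fin 2) ℝ) (ε : Fin N → SignType)
    (a : ℝ → Fin 2 → ℝ) : Prop :=
  ContinuousOn a (Set.Icc 0 1) ∧
    ∀ q ∈ crossings B ε a, ∃ v : Fin 2 → ℝ, HasDerivAt a v q.1 ∧
      Submodule.span ℝ {v} ⊔ LinearMap.range (fderiv ℝ (xi B) q.2).toLinearMap = ⊤

/-- The depth of `C`: the minimum number of intersections with the curve of a transversal path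
from a point of `C` to a point of an outer chamber (`⊤` if there is no such path). -/
def depth {n : ℕ} (A : Fin (n + 3) → Fin n → ℝ) (B : Matrix (Fin (n + 3)) (Fin 2) ℝ)
    (ε : Fin (n + 3) → SignType) (C : Set (Fin 2 → ℝ)) : ℕ∞ :=
  ⨅ (a : ℝ → Fin 2 → ℝ) (_ : IsTransversalPath B ε a) (_ : a 0 ∈ C)
    (_ : ∃ D, IsOuter (curve A B ε) D ∧ a 1 ∈ D), (crossings B ε a).encard

/-- Two different chambers are adjacent if their common boundary contains an arc of the curve,
i.e. the image of a nonempty open set of parameters. -/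
def Adjacent {N : ℕ} (B : Matrix (Fin N) (Fin 2) ℝ) (ε : Fin N → SignType)
    (C D : Set (Fin 2 → ℝ)) : Prop :=
  C ≠ D ∧ ∃ V : Set (Fin 2 → ℝ), IsOpen V ∧ V.Nonempty ∧ V ⊆ cone B ε ∧
    xi B '' V ⊆ frontier C ∩ frontier D

end

end NearCircuit

/-! The parameter space `params` is an open segment `p + t • v`, and the Jacobian of `xi` at `l` is
symmetric with kernel containing `l`. Its image is therefore orthogonal to `l`, so `γ t = xi B (p +
t • v)` has velocity `h t • rot (p + t • v)`: the normal is affine in the parameter, and the cusps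
are the zeros of `h`. This is `IsFront`, proved in `exists_isFront`.

For a direction `d`, the function `cross d (γ t)` has derivative `h t * (d ⬝ᵥ (p + t • v))`. It
vanishes at the `m` cusps and at no more than one further point, so Rolle would allow `m + 2` points
on a line of direction `d`. The count `max m 1` comes from choosing `d` well (`exists_direction`). A
direction orthogonal to `v` has no tangency at all, leaving `m` zeros. If `h` keeps its sign at some
cusp, that zero is harmless for Rolle; if `h` changes sign there, taking `d` tangent to the front at
the cusp cancels the change. Either way only `m - 1` zeros count.

A point of a chamber now splits a generic line of direction `d` into two rays leading to outer
chambers. One of them meets the front at most `m / 2` times (`depth_le_half`). An inner chamber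
cannot be left without a crossing (`one_le_depth`), which settles two or three cusps. For four
cusps, take a generic line through an arc separating a chamber of depth 2 from a neighbour of depth
at least 2: it would meet the front at least `2 + 1 + 2` times (`depth_eq_one_of_adjacent`).

The curve need not be closed, because its ends may have finite limits. `exists_finite_ends` confines
the trouble to finitely many points, which the generic choices avoid. -/

namespace NearCircuit

open Set Filter Topology

/-! ### Rolle's theorem, level counts and behaviour at the ends of an interval. -/

section RealFunctions

/-- If any two points of a level of `f` are separated by a point of `Z`, the levels of `f` have at
most `|Z| + 1` points. -/
theorem level_encard_le {s : Set ℝ} (Z : Finset ℝ) {f : ℝ → ℝ}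
    (hf : ∀ x ∈ s, ∀ y ∈ s, x < y → f x = f y → ∃ z ∈ Z, x < z ∧ z < y) (c : ℝ) :
    {t | t ∈ s ∧ f t = c}.encard ≤ ((Z.card + 1 : ℕ) : ℕ∞) := by
  by_contra hlt
  have hle : ((Z.card + 2 : ℕ) : ℕ∞) ≤ {t | t ∈ s ∧ f t = c}.encard := by
    have := Order.add_one_le_of_lt (not_le.mp hlt)
    exact_mod_cast this
  obtain ⟨T, hTs, hT⟩ := Set.exists_subset_encard_eq hle
  have hfin : T.Finite := Set.finite_of_encard_eq_coe hT
  have h1 : hfin.toFinset.card ≤ Z.card + 1 := by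
    apply Finset.card_le_of_interleaved
    intro x hx y hy hxy _
    have hx' := hTs (hfin.mem_toFinset.mp hx)
    have hy' := hTs (hfin.mem_toFinset.mp hy)
    exact hf x hx'.1 y hy'.1 hxy (hx'.2.trans hy'.2.symm)
  have h2 : hfin.toFinset.card = Z.card + 2 := by
    rw [hfin.encard_eq_coe_toFinset_card] at hT
    exact_mod_cast hT
  omega

variable {a b : ℝ} {f f' : ℝ → ℝ}

theorem exists_deriv_zero_of_eq (hf : ∀ t ∈ Ioo a b, HasDerivAt f (f' t) t) {x y : ℝ}
    (hx : x ∈ Ioo a b) (hy : y ∈ Ioo a b) (hxy : x < y) (h : f x = f y) :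
    ∃ z ∈ Ioo x y, f' z = 0 := by
  have hsub : Icc x y ⊆ Ioo a b := fun t ht => ⟨hx.1.trans_le ht.1, ht.2.trans_lt hy.2⟩
  exact exists_hasDerivAt_eq_zero hxy
    (fun t ht => (hf t (hsub ht)).continuousAt.continuousWithinAt) h
    (fun t ht => hf t (hsub (Ioo_subset_Icc_self ht)))

theorem pos_of_ne_zero_of_pos {s : Set ℝ} (hs : s.OrdConnected) (hc : ContinuousOn f s)
    (h0 : ∀ t ∈ s, f t ≠ 0) {u v : ℝ} (hu : u ∈ s) (hv : v ∈ s) (hpos : 0 < f u) : 0 < f v := by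
  by_contra hneg
  have hlt : f v ≤ 0 := not_lt.mp hneg
  obtain ⟨z, hz, hz0⟩ := hs.isPreconnected.intermediate_value hv hu hc ⟨hlt, hpos.le⟩
  exact h0 z hz hz0

/-- A zero of the derivative without change of sign does not matter in Rolle's theorem. -/
theorem exists_deriv_zero_ne_of_pos (hf : ∀ t ∈ Ioo a b, HasDerivAt f (f' t) t)
    (hc : ContinuousOn f' (Ioo a b)) {τ u v : ℝ} (hu : u ∈ Ioo a b) (hv : v ∈ Ioo a b)
    (huτ : u < τ) (hτv : τ < v) (h0 : ∀ t ∈ Icc u v, t ≠ τ → f' t ≠ 0)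
    (hpu : 0 < f' u) (hpv : 0 < f' v) {x y : ℝ}
    (hx : x ∈ Ioo a b) (hy : y ∈ Ioo a b) (hxy : x < y) (h : f x = f y) :
    ∃ z ∈ Ioo x y, z ≠ τ ∧ f' z = 0 := by
  by_contra! hno
  have hτ : τ ∈ Ioo x y := by
    obtain ⟨z, hz, hz0⟩ := exists_deriv_zero_of_eq hf hx hy hxy h
    by_cases hzτ : z = τ
    · exact hzτ ▸ hz
    · exact absurd hz0 (hno z hz hzτ)
  have hτab : τ ∈ Ioo a b := ⟨hu.1.trans huτ, hτv.trans hv.2⟩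
  -- The interval from `min u t` to `τ` is covered by `[u, τ)` and `[t, τ)`. Both are free of zeros,
  -- so the sign of `f'` travels from `u` to `t`. The other side of `τ` is symmetric, and `f`
  -- increases across `τ`, contradicting `f x = f y`.
  have hleft : ∀ t ∈ Ioo x τ, 0 < f' t := by
    intro t ht
    have hsub : Ico (min u t) τ ⊆ Ioo a b := fun r hr =>
      ⟨(lt_min hu.1 (hx.1.trans ht.1)).trans_le hr.1, hr.2.trans hτab.2⟩
    refine pos_of_ne_zero_of_pos (s := Ico (min u t) τ) ordConnected_Ico (hc.mono hsub) ?_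
      ⟨min_le_left _ _, huτ⟩ ⟨min_le_right _ _, ht.2⟩ hpu
    intro r hr
    rcases min_le_iff.mp hr.1 with hr1 | hr1
    · exact h0 r ⟨hr1, (hr.2.trans hτv).le⟩ hr.2.ne
    · exact hno r ⟨ht.1.trans_le hr1, hr.2.trans hτ.2⟩ hr.2.ne
  have hright : ∀ t ∈ Ioo τ y, 0 < f' t := by
    intro t ht
    have hsub : Ioc τ (max v t) ⊆ Ioo a b := fun r hr =>
      ⟨hτab.1.trans hr.1, hr.2.trans_lt (max_lt hv.2 (ht.2.trans hy.2))⟩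
    refine pos_of_ne_zero_of_pos (s := Ioc τ (max v t)) ordConnected_Ioc (hc.mono hsub) ?_
      ⟨hτv, le_max_left _ _⟩ ⟨ht.1, le_max_right _ _⟩ hpv
    intro r hr
    rcases le_max_iff.mp hr.2 with hr1 | hr1
    · exact h0 r ⟨(huτ.trans hr.1).le, hr1⟩ hr.1.ne'
    · exact hno r ⟨hτ.1.trans hr.1, hr1.trans_lt ht.2⟩ hr.1.ne'
  have hcf : ContinuousOn f (Ioo a b) := fun t ht => (hf t ht).continuousAt.continuousWithinAt
  have m1 : StrictMonoOn f (Icc x τ) := by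
    have hsub : Icc x τ ⊆ Ioo a b := fun r hr => ⟨hx.1.trans_le hr.1, hr.2.trans_lt hτab.2⟩
    refine strictMonoOn_of_deriv_pos (convex_Icc _ _) (hcf.mono hsub) fun t ht => ?_
    rw [interior_Icc] at ht
    rw [(hf t (hsub (Ioo_subset_Icc_self ht))).deriv]
    exact hleft t ht
  have m2 : StrictMonoOn f (Icc τ y) := by
    have hsub : Icc τ y ⊆ Ioo a b := fun r hr => ⟨hτab.1.trans_le hr.1, hr.2.trans_lt hy.2⟩
    refine strictMonoOn_of_deriv_pos (convex_Icc _ _) (hcf.mono hsub) fun t ht => ?_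
    rw [interior_Icc] at ht
    rw [(hf t (hsub (Ioo_subset_Icc_self ht))).deriv]
    exact hright t ht
  have l1 := m1 (left_mem_Icc.mpr hτ.1.le) (right_mem_Icc.mpr hτ.1.le) hτ.1
  have l2 := m2 (left_mem_Icc.mpr hτ.2.le) (right_mem_Icc.mpr hτ.2.le) hτ.2
  linarith

/-- The product condition covers both signs, by passing to `-f`. It lets one cusp be discarded from
the Rolle count. -/
theorem exists_deriv_zero_ne (hf : ∀ t ∈ Ioo a b, HasDerivAt f (f' t) t)
    (hc : ContinuousOn f' (Ioo a b)) {τ u v : ℝ} (hu : u ∈ Ioo a b) (hv : v ∈ Ioo a b)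
    (huτ : u < τ) (hτv : τ < v) (h0 : ∀ t ∈ Icc u v, t ≠ τ → f' t ≠ 0)
    (huv : 0 < f' u * f' v) {x y : ℝ}
    (hx : x ∈ Ioo a b) (hy : y ∈ Ioo a b) (hxy : x < y) (h : f x = f y) :
    ∃ z ∈ Ioo x y, z ≠ τ ∧ f' z = 0 := by
  rcases pos_and_pos_or_neg_and_neg_of_mul_pos huv with ⟨h1, h2⟩ | ⟨h1, h2⟩
  · exact exists_deriv_zero_ne_of_pos hf hc hu hv huτ hτv h0 h1 h2 hx hy hxy h
  · obtain ⟨z, hz, hzτ, hz0⟩ := exists_deriv_zero_ne_of_pos (f := fun t => - f t)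
      (f' := fun t => - f' t) (fun t ht => (hf t ht).neg) hc.neg hu hv huτ hτv
      (fun t ht htτ => neg_ne_zero.mpr (h0 t ht htτ)) (neg_pos.mpr h1) (neg_pos.mpr h2) hx hy hxy
      (congrArg Neg.neg h)
    exact ⟨z, hz, hzτ, neg_eq_zero.mp hz0⟩

/-- A monotone function has a limit in the extended reals. The conclusion records only that all
other real values are avoided near the end, so infinite limits need no separate statement. -/
theorem exists_limit_left_of_strictMonoOn (hab : a < b) (hf : StrictMonoOn f (Ioo a b)) :
    ∃ l, ∀ y, y ≠ l → ∃ δ > 0, ∃ t' ∈ Ioo a b, ∀ t ∈ Ioo a t', δ ≤ |f t - y| := by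
  have hbelow : ∀ y, (∃ t' ∈ Ioo a b, f t' < y) →
      ∃ δ > 0, ∃ t' ∈ Ioo a b, ∀ t ∈ Ioo a t', δ ≤ |f t - y| := by
    rintro y ⟨t', ht', hy⟩
    refine ⟨y - f t', sub_pos.mpr hy, t', ht', fun t ht => ?_⟩
    have := hf ⟨ht.1, ht.2.trans ht'.2⟩ ht' ht.2
    rw [abs_sub_comm]
    exact le_trans (by linarith) (le_abs_self _)
  have hne : (f '' Ioo a b).Nonempty := (nonempty_Ioo.mpr hab).image f
  -- If the image is unbounded below, `sInf` is a default value. This does no harm: every `y` then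
  -- lies above some value of `f` and falls under `hbelow`.
  refine ⟨sInf (f '' Ioo a b), fun y hy => ?_⟩
  by_cases hlt : ∃ t' ∈ Ioo a b, f t' < y
  · exact hbelow y hlt
  · push Not at hlt
    have hle : y ≤ sInf (f '' Ioo a b) := le_csInf hne (by rintro _ ⟨t, ht, rfl⟩; exact hlt t ht)
    have hbdd : BddBelow (f '' Ioo a b) := ⟨y, by rintro _ ⟨t, ht, rfl⟩; exact hlt t ht⟩
    obtain ⟨t', ht'⟩ := nonempty_Ioo.mpr hab
    refine ⟨sInf (f '' Ioo a b) - y, sub_pos.mpr (lt_of_le_of_ne hle hy), t', ht', fun t ht => ?_⟩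
    have := csInf_le hbdd (mem_image_of_mem f (⟨ht.1, ht.2.trans ht'.2⟩ : t ∈ Ioo a b))
    exact le_trans (by linarith) (le_abs_self _)

theorem exists_limit_left_of_injOn (hab : a < b) (hc : ContinuousOn f (Ioo a b))
    (hf : InjOn f (Ioo a b)) :
    ∃ l, ∀ y, y ≠ l → ∃ δ > 0, ∃ t' ∈ Ioo a b, ∀ t ∈ Ioo a t', δ ≤ |f t - y| := by
  rcases hc.strictMonoOn_of_injOn_Ioo hab hf with h | h
  · exact exists_limit_left_of_strictMonoOn hab h
  · obtain ⟨l, hl⟩ := exists_limit_left_of_strictMonoOn (f := fun t => - f t) hab h.neg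
    refine ⟨-l, fun y hy => ?_⟩
    obtain ⟨δ, hδ, t', ht', H⟩ := hl (-y) (fun e => hy (by rw [← e, neg_neg]))
    refine ⟨δ, hδ, t', ht', fun t ht => (H t ht).trans_eq ?_⟩
    rw [abs_sub_comm]
    congr 1
    ring

theorem exists_limit_right_of_injOn (hab : a < b) (hc : ContinuousOn f (Ioo a b))
    (hf : InjOn f (Ioo a b)) :
    ∃ l, ∀ y, y ≠ l → ∃ δ > 0, ∃ t' ∈ Ioo a b, ∀ t ∈ Ioo t' b, δ ≤ |f t - y| := by
  have hmaps : MapsTo (fun t : ℝ => -t) (Ioo (-b) (-a)) (Ioo a b) := fun t ht =>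
    ⟨by linarith [ht.2], by linarith [ht.1]⟩
  obtain ⟨l, hl⟩ := exists_limit_left_of_injOn (f := fun t => f (-t)) (neg_lt_neg hab)
    (hc.comp continuous_neg.continuousOn hmaps)
    (fun x hx y hy h => neg_injective (hf (hmaps hx) (hmaps hy) h))
  refine ⟨l, fun y hy => ?_⟩
  obtain ⟨δ, hδ, t', ht', H⟩ := hl y hy
  refine ⟨δ, hδ, -t', hmaps ht', fun t ht => ?_⟩
  simpa using H (-t) ⟨by linarith [ht.2], by linarith [ht.1]⟩

/-- A function whose derivative has finitely many zeros stays, near an end of its interval of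
definition, away from all values but one. -/
theorem exists_limits_of_finite_deriv_zeros (hab : a < b)
    (hf : ∀ t ∈ Ioo a b, HasDerivAt f (f' t) t) (hZ : {t | t ∈ Ioo a b ∧ f' t = 0}.Finite) :
    (∃ l, ∀ y, y ≠ l → ∃ δ > 0, ∃ t' ∈ Ioo a b, ∀ t ∈ Ioo a t', δ ≤ |f t - y|) ∧
    (∃ l, ∀ y, y ≠ l → ∃ δ > 0, ∃ t' ∈ Ioo a b, ∀ t ∈ Ioo t' b, δ ≤ |f t - y|) := by
  have hcf : ContinuousOn f (Ioo a b) := fun t ht => (hf t ht).continuousAt.continuousWithinAt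
  have hinj : ∀ u v, Ioo u v ⊆ Ioo a b → (∀ t ∈ Ioo u v, f' t ≠ 0) → InjOn f (Ioo u v) := by
    intro u v hs h0 x hx y hy hxy
    by_contra hne
    rcases lt_or_gt_of_ne hne with hlt | hlt
    · obtain ⟨z, hz, hz0⟩ := exists_deriv_zero_of_eq hf (hs hx) (hs hy) hlt hxy
      exact h0 z ⟨hx.1.trans hz.1, hz.2.trans hy.2⟩ hz0
    · obtain ⟨z, hz, hz0⟩ := exists_deriv_zero_of_eq hf (hs hy) (hs hx) hlt hxy.symm
      exact h0 z ⟨hy.1.trans hz.1, hz.2.trans hx.2⟩ hz0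
  constructor
  · obtain ⟨c, hc, hcZ⟩ : ∃ c ∈ Ioo a b, ∀ t ∈ Ioo a c, f' t ≠ 0 := by
      have h1 : ∀ᶠ c in 𝓝[>] a, c ∈ Ioo a b := Ioo_mem_nhdsGT hab
      have h2 : ∀ᶠ c in 𝓝[>] a, ∀ z ∈ {t | t ∈ Ioo a b ∧ f' t = 0}, c < z :=
        (hZ.eventually_all).mpr fun z hz => by
          filter_upwards [Ioo_mem_nhdsGT hz.1.1] with c hc using hc.2
      obtain ⟨c, h1, h2⟩ := (h1.and h2).exists
      exact ⟨c, h1, fun t ht h => (h2 t ⟨⟨ht.1, ht.2.trans h1.2⟩, h⟩).not_gt ht.2⟩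
    have hs : Ioo a c ⊆ Ioo a b := Ioo_subset_Ioo_right hc.2.le
    obtain ⟨l, hl⟩ := exists_limit_left_of_injOn hc.1 (hcf.mono hs) (hinj a c hs hcZ)
    refine ⟨l, fun y hy => ?_⟩
    obtain ⟨δ, hδ, t', ht', H⟩ := hl y hy
    exact ⟨δ, hδ, t', hs ht', H⟩
  · obtain ⟨c, hc, hcZ⟩ : ∃ c ∈ Ioo a b, ∀ t ∈ Ioo c b, f' t ≠ 0 := by
      have h1 : ∀ᶠ c in 𝓝[<] b, c ∈ Ioo a b := Ioo_mem_nhdsLT hab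
      have h2 : ∀ᶠ c in 𝓝[<] b, ∀ z ∈ {t | t ∈ Ioo a b ∧ f' t = 0}, z < c :=
        (hZ.eventually_all).mpr fun z hz => by
          filter_upwards [Ioo_mem_nhdsLT hz.1.2] with c hc using hc.1
      obtain ⟨c, h1, h2⟩ := (h1.and h2).exists
      exact ⟨c, h1, fun t ht h => (h2 t ⟨⟨h1.1.trans ht.1, ht.2⟩, h⟩).not_gt ht.1⟩
    have hs : Ioo c b ⊆ Ioo a b := Ioo_subset_Ioo_left hc.1.le
    obtain ⟨l, hl⟩ := exists_limit_right_of_injOn hc.2 (hcf.mono hs) (hinj c b hs hcZ)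
    refine ⟨l, fun y hy => ?_⟩
    obtain ⟨δ, hδ, t', ht', H⟩ := hl y hy
    exact ⟨δ, hδ, t', hs ht', H⟩

end RealFunctions

/-! ### Plane fronts whose normal is affine in the parameter. -/

section Fronts

/-- The determinant of two vectors of the plane. -/
def cross (x y : Fin 2 → ℝ) : ℝ := x 0 * y 1 - x 1 * y 0

/-- Rotation of the plane by a right angle. -/
def rot (x : Fin 2 → ℝ) : Fin 2 → ℝ := ![-x 1, x 0]

theorem cross_add_smul (d x : Fin 2 → ℝ) (s : ℝ) : cross d (x + s • d) = cross d x := by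
  simp [cross]; ring

theorem cross_add_smul_rot (d x : Fin 2 → ℝ) (u : ℝ) :
    cross d (x + u • rot d) = cross d x + u * (d ⬝ᵥ d) := by
  simp [cross, rot, dotProduct]; ring

theorem cross_rot (x y : Fin 2 → ℝ) : cross x (rot y) = x ⬝ᵥ y := by
  simp [cross, rot, dotProduct]

theorem dotProduct_self_pos {d : Fin 2 → ℝ} (hd : d ≠ 0) : 0 < d ⬝ᵥ d := by
  simp only [dotProduct, Fin.sum_univ_two]
  by_contra hle
  apply hd
  have h0 := mul_self_nonneg (d 0)
  have h1 := mul_self_nonneg (d 1)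
  have e0 : d 0 * d 0 = 0 := by linarith
  have e1 : d 1 * d 1 = 0 := by linarith
  ext i
  fin_cases i
  · simpa using e0
  · simpa using e1

/-- The coordinates of the plane in the orthogonal basis `d`, `rot d`. -/
theorem eq_add_smul_add_smul_rot {d : Fin 2 → ℝ} (hd : d ≠ 0) (x y : Fin 2 → ℝ) :
    y = x + (d ⬝ᵥ (y - x) / (d ⬝ᵥ d)) • d + (cross d (y - x) / (d ⬝ᵥ d)) • rot d := by
  have h := (dotProduct_self_pos hd).ne'
  ext i
  apply mul_left_cancel₀ h
  simp only [Pi.add_apply, Pi.smul_apply, smul_eq_mul, mul_add, div_mul_eq_mul_div,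
    mul_div_cancel₀ _ h]
  fin_cases i <;> simp [cross, rot, dotProduct] <;> ring

theorem exists_eq_add_smul_of_cross_eq {d : Fin 2 → ℝ} (hd : d ≠ 0) {x y : Fin 2 → ℝ}
    (h : cross d y = cross d x) : ∃ s : ℝ, y = x + s • d := by
  refine ⟨d ⬝ᵥ (y - x) / (d ⬝ᵥ d), (eq_add_smul_add_smul_rot hd x y).trans ?_⟩
  have : cross d (y - x) = 0 := by
    simp only [cross, Pi.sub_apply] at h ⊢; linarith
  rw [this]; simp

/-- A plane curve `γ` on `(a, b)` whose normal at the parameter `t` is `p + t • v`; its cusps are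
the zeros of the speed `h`. -/
structure IsFront (a b : ℝ) (γ : ℝ → Fin 2 → ℝ) (h : ℝ → ℝ) (p v : Fin 2 → ℝ) : Prop where
  lt : a < b
  continuousOn_speed : ContinuousOn h (Ioo a b)
  hasDerivAt : ∀ t ∈ Ioo a b, HasDerivAt γ (h t • rot (p + t • v)) t
  cross_eq_one : cross p v = 1

namespace IsFront

variable {a b : ℝ} {γ : ℝ → Fin 2 → ℝ} {h : ℝ → ℝ} {p v : Fin 2 → ℝ}

theorem continuousOn (hF : IsFront a b γ h p v) : ContinuousOn γ (Ioo a b) :=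
  fun t ht => (hF.hasDerivAt t ht).continuousAt.continuousWithinAt

theorem hasDerivAt_cross (hF : IsFront a b γ h p v) (d : Fin 2 → ℝ) {t : ℝ} (ht : t ∈ Ioo a b) :
    HasDerivAt (fun t => cross d (γ t)) (h t * (d ⬝ᵥ (p + t • v))) t := by
  have h0 := (hasDerivAt_pi.mp (hF.hasDerivAt t ht)) 0
  have h1 := (hasDerivAt_pi.mp (hF.hasDerivAt t ht)) 1
  refine ((h1.const_mul (d 0)).sub (h0.const_mul (d 1))).congr_deriv ?_
  simp [rot, dotProduct]; ring

theorem cross_normal (hF : IsFront a b γ h p v) (s t : ℝ) :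
    cross (p + s • v) (p + t • v) = t - s := by
  have := hF.cross_eq_one
  simp only [cross, Pi.add_apply, Pi.smul_apply, smul_eq_mul] at this ⊢
  linear_combination (t - s) * this

theorem continuousOn_deriv_cross (hF : IsFront a b γ h p v) (d : Fin 2 → ℝ) :
    ContinuousOn (fun t => h t * (d ⬝ᵥ (p + t • v))) (Ioo a b) := by
  refine hF.continuousOn_speed.mul (Continuous.continuousOn ?_)
  simp only [dotProduct, Fin.sum_univ_two, Pi.add_apply, Pi.smul_apply, smul_eq_mul]
  fun_prop

theorem dotProduct_normal_subsingleton (hF : IsFront a b γ h p v) {d : Fin 2 → ℝ} (hd : d ≠ 0) :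
    {t : ℝ | d ⬝ᵥ (p + t • v) = 0}.Subsingleton := by
  intro s hs t ht
  by_contra hst
  apply hd
  have hc := hF.cross_normal s t
  simp only [mem_ofPred_eq, dotProduct, Fin.sum_univ_two] at hs ht
  simp only [cross] at hc
  have hne : t - s ≠ 0 := sub_ne_zero.mpr (Ne.symm hst)
  ext i
  apply mul_left_cancel₀ hne
  rw [← hc]
  fin_cases i
  · simp only [Pi.zero_apply, mul_zero, Fin.zero_eta]
    linear_combination (p + t • v) 1 * hs - (p + s • v) 1 * ht
  · simp only [Pi.zero_apply, mul_zero, Fin.mk_one]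
    linear_combination (p + s • v) 0 * ht - (p + t • v) 0 * hs

theorem injOn_cross (hF : IsFront a b γ h p v) {d : Fin 2 → ℝ} {s : Set ℝ} (hs : s.OrdConnected)
    (hsub : s ⊆ Ioo a b) (h0 : ∀ t ∈ s, h t * (d ⬝ᵥ (p + t • v)) ≠ 0) :
    InjOn (fun t => cross d (γ t)) s := by
  intro x hx y hy hxy
  by_contra hne
  rcases lt_or_gt_of_ne hne with hlt | hlt
  · obtain ⟨z, hz, hz0⟩ := exists_deriv_zero_of_eq (fun t ht => hF.hasDerivAt_cross d ht)
      (hsub hx) (hsub hy) hlt hxy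
    exact h0 z (hs.out hx hy (Ioo_subset_Icc_self hz)) hz0
  · obtain ⟨z, hz, hz0⟩ := exists_deriv_zero_of_eq (fun t ht => hF.hasDerivAt_cross d ht)
      (hsub hy) (hsub hx) hlt hxy.symm
    exact h0 z (hs.out hy hx (Ioo_subset_Icc_self hz)) hz0

/-- A front with `m` cusps has a direction `d`, tangent to the front at most at cusps, such that
every line of direction `d` meets the front at most `max m 1` times. -/
theorem exists_direction (hF : IsFront a b γ h p v) {m : ℕ}
    (hm : {t | t ∈ Ioo a b ∧ h t = 0}.encard = m) :
    ∃ d : Fin 2 → ℝ, d ≠ 0 ∧ (∀ t ∈ Ioo a b, h t ≠ 0 → d ⬝ᵥ (p + t • v) ≠ 0) ∧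
      ∀ c, {t | t ∈ Ioo a b ∧ cross d (γ t) = c}.encard ≤ ((max m 1 : ℕ) : ℕ∞) := by
  have hfin : {t | t ∈ Ioo a b ∧ h t = 0}.Finite := Set.finite_of_encard_eq_coe hm
  have hcard : hfin.toFinset.card = m := by
    rw [hfin.encard_eq_coe_toFinset_card] at hm
    exact_mod_cast hm
  -- This direction is orthogonal to `v`, so its product with the normal is constant: no parameter
  -- gives a tangency.
  have hd₁ : ∀ t : ℝ, ![v 1, -v 0] ⬝ᵥ (p + t • v) = 1 := by
    intro t
    rw [← hF.cross_eq_one]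
    simp [dotProduct, cross]; ring
  have hd₁_ne : (![v 1, -v 0] : Fin 2 → ℝ) ≠ 0 := by
    intro e
    have := hd₁ 0
    rw [e, zero_dotProduct] at this
    exact zero_ne_one this
  rcases Nat.eq_zero_or_pos m with rfl | hmpos
  · have hne : ∀ t ∈ Ioo a b, h t ≠ 0 := by
      intro t ht h0
      rw [Nat.cast_zero, Set.encard_eq_zero] at hm
      exact (hm ▸ (⟨ht, h0⟩ : t ∈ {t | t ∈ Ioo a b ∧ h t = 0}) : t ∈ (∅ : Set ℝ))
    refine ⟨_, hd₁_ne, fun t _ _ => by rw [hd₁]; exact one_ne_zero, fun c => ?_⟩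
    have := level_encard_le (s := Ioo a b) ∅ (f := fun t => cross ![v 1, -v 0] (γ t)) ?_ c
    · simpa using this
    · intro x hx y hy hxy hf
      obtain ⟨z, hz, hz0⟩ := exists_deriv_zero_of_eq (fun t ht => hF.hasDerivAt_cross _ ht)
        hx hy hxy hf
      rw [hd₁, mul_one] at hz0
      exact absurd hz0 (hne z ⟨hx.1.trans hz.1, hz.2.trans hy.2⟩)
  obtain ⟨τ, hτ⟩ : hfin.toFinset.Nonempty := Finset.card_pos.mp (hcard ▸ hmpos)
  have hτ' : τ ∈ Ioo a b ∧ h τ = 0 := hfin.mem_toFinset.mp hτ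
  obtain ⟨r, hr, hrsub, hr0⟩ : ∃ r > 0, Icc (τ - r) (τ + r) ⊆ Ioo a b ∧
      ∀ t ∈ Icc (τ - r) (τ + r), t ≠ τ → h t ≠ 0 := by
    have hopen : IsOpen (Ioo a b \ (({t | t ∈ Ioo a b ∧ h t = 0} : Set ℝ) \ {τ})) :=
      isOpen_Ioo.sdiff (hfin.subset sdiff_subset).isClosed
    obtain ⟨r, hr, hb⟩ := Metric.nhds_basis_closedBall.mem_iff.mp
      (hopen.mem_nhds ⟨hτ'.1, fun h => h.2 rfl⟩)
    rw [Real.closedBall_eq_Icc] at hb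
    exact ⟨r, hr, fun t ht => (hb ht).1, fun t ht hne h0 => (hb ht).2 ⟨⟨(hb ht).1, h0⟩, hne⟩⟩
  have hu : τ - r ∈ Icc (τ - r) (τ + r) := ⟨le_rfl, by linarith⟩
  have hv : τ + r ∈ Icc (τ - r) (τ + r) := ⟨by linarith, le_rfl⟩
  have hu0 := hr0 _ hu (by linarith)
  have hv0 := hr0 _ hv (by linarith)
  obtain ⟨d, hd0, hdt, hds⟩ : ∃ d : Fin 2 → ℝ, d ≠ 0 ∧ (∀ t, t ≠ τ → d ⬝ᵥ (p + t • v) ≠ 0) ∧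
      0 < h (τ - r) * (d ⬝ᵥ (p + (τ - r) • v)) * (h (τ + r) * (d ⬝ᵥ (p + (τ + r) • v))) := by
    -- If `h` changes sign at `τ`, the tangent direction at the cusp adds the factor `t - τ`, which
    -- changes sign as well. If not, the direction orthogonal to `v` leaves the sign of `h` intact.
    rcases lt_or_gt_of_ne (mul_ne_zero hu0 hv0) with hs | hs
    · have hd : ∀ t : ℝ, rot (p + τ • v) ⬝ᵥ (p + t • v) = t - τ := by
        intro t
        rw [← hF.cross_normal τ t]
        simp [dotProduct, cross, rot]; ring
      refine ⟨rot (p + τ • v), ?_, fun t ht => by rw [hd]; exact sub_ne_zero.mpr ht, ?_⟩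
      · intro e
        have := hd (τ + 1)
        rw [e, zero_dotProduct] at this
        linarith
      · rw [hd, hd]
        nlinarith [mul_pos hr hr]
    · refine ⟨_, hd₁_ne, fun t _ => by rw [hd₁]; exact one_ne_zero, ?_⟩
      rw [hd₁, hd₁, mul_one, mul_one]
      exact hs
  refine ⟨d, hd0, fun t ht h0 => hdt t (fun e => h0 (e ▸ hτ'.2)), fun c => ?_⟩
  have := level_encard_le (s := Ioo a b) (hfin.toFinset.erase τ) (f := fun t => cross d (γ t)) ?_ c
  · rw [Finset.card_erase_of_mem hτ, hcard, Nat.sub_add_cancel hmpos] at this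
    rwa [max_eq_left hmpos]
  · intro x hx y hy hxy hf
    obtain ⟨z, hz, hzτ, hz0⟩ := exists_deriv_zero_ne (fun t ht => hF.hasDerivAt_cross d ht)
      (hF.continuousOn_deriv_cross d) (hrsub hu) (hrsub hv) (by linarith) (by linarith)
      (fun t ht hne => mul_ne_zero (hr0 t ht hne) (hdt t hne)) hds hx hy hxy hf
    refine ⟨z, Finset.mem_erase.mpr ⟨hzτ, hfin.mem_toFinset.mpr ?_⟩, hz⟩
    exact ⟨⟨hx.1.trans hz.1, hz.2.trans hy.2⟩, (mul_eq_zero.mp hz0).resolve_right (hdt z hzτ)⟩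

/-- The curve is proper away from finitely many points, the possible finite limits at its ends. -/
theorem exists_finite_ends (hF : IsFront a b γ h p v) (hZ : {t | t ∈ Ioo a b ∧ h t = 0}.Finite) :
    ∃ Q : Set (Fin 2 → ℝ), Q.Finite ∧ ∀ y ∉ Q, ∃ u w, Icc u w ⊆ Ioo a b ∧ ∃ δ > 0,
      ∀ t ∈ Ioo a b, dist (γ t) y < δ → t ∈ Icc u w := by
  have key : ∀ i : Fin 2,
      (∃ l, ∀ y, y ≠ l → ∃ δ > 0, ∃ t' ∈ Ioo a b, ∀ t ∈ Ioo a t', δ ≤ |γ t i - y|) ∧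
      (∃ l, ∀ y, y ≠ l → ∃ δ > 0, ∃ t' ∈ Ioo a b, ∀ t ∈ Ioo t' b, δ ≤ |γ t i - y|) := by
    intro i
    -- Each coordinate is `cross d` for a suitable `d`, so its derivative has finitely many zeros
    -- and the end behaviour of real functions applies.
    obtain ⟨d, hd0, hd⟩ : ∃ d : Fin 2 → ℝ, d ≠ 0 ∧ ∀ y, cross d y = y i := by
      fin_cases i
      · exact ⟨![0, -1], fun e => by simpa using congrFun e 1, fun y => by simp [cross]⟩
      · exact ⟨![1, 0], fun e => by simpa using congrFun e 0, fun y => by simp [cross]⟩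
    have := exists_limits_of_finite_deriv_zeros hF.lt
      (fun t ht => hF.hasDerivAt_cross d ht) ?_
    · simpa only [hd] using this
    · refine (hZ.union (hF.dotProduct_normal_subsingleton hd0).finite).subset ?_
      rintro t ⟨ht, h0⟩
      rcases mul_eq_zero.mp h0 with h0 | h0
      · exact Or.inl ⟨ht, h0⟩
      · exact Or.inr h0
  choose L hL using fun i => (key i).1
  choose R hR using fun i => (key i).2
  -- `L` and `R` collect the coordinatewise candidates for the two end limits. Any other `y` differs
  -- from each in some coordinate, which keeps both ends of the curve away from `y`.
  refine ⟨{L, R}, by simp, fun y hy => ?_⟩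
  simp only [mem_insert_iff, mem_singleton_iff, not_or] at hy
  obtain ⟨i, hi⟩ := Function.ne_iff.mp hy.1
  obtain ⟨j, hj⟩ := Function.ne_iff.mp hy.2
  obtain ⟨δ₁, hδ₁, u, hu, H₁⟩ := hL i (y i) hi
  obtain ⟨δ₂, hδ₂, w, hw, H₂⟩ := hR j (y j) hj
  refine ⟨u, w, fun t ht => ⟨hu.1.trans_le ht.1, ht.2.trans_lt hw.2⟩, min δ₁ δ₂,
    lt_min hδ₁ hδ₂, fun t ht hdist => ⟨?_, ?_⟩⟩
  · by_contra hlt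
    have h1 := H₁ t ⟨ht.1, not_le.mp hlt⟩
    have h2 : |γ t i - y i| ≤ dist (γ t) y := dist_le_pi_dist (γ t) y i
    exact absurd (h1.trans h2) (not_le.mpr (hdist.trans_le (min_le_left _ _)))
  · by_contra hlt
    have h1 := H₂ t ⟨not_le.mp hlt, ht.2⟩
    have h2 : |γ t j - y j| ≤ dist (γ t) y := dist_le_pi_dist (γ t) y j
    exact absurd (h1.trans h2) (not_le.mpr (hdist.trans_le (min_le_right _ _)))

/-- The smooth points of a front at which it meets itself have countably many parameters. -/
theorem countable_selfIntersections (hF : IsFront a b γ h p v) :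
    {t | t ∈ Ioo a b ∧ h t ≠ 0 ∧ ∃ s ∈ Ioo a b, h s ≠ 0 ∧ s ≠ t ∧ γ s = γ t}.Countable := by
  set S : Set (ℝ × ℝ) := {z | z.1 ∈ Ioo a b ∧ z.2 ∈ Ioo a b ∧ h z.1 ≠ 0 ∧ h z.2 ≠ 0 ∧
    z.2 ≠ z.1 ∧ γ z.2 = γ z.1}
  have hdisc : DiscreteTopology S := by
    rw [discreteTopology_subtype_iff]
    rintro ⟨t, s⟩ ⟨ht, hs, ht0, hs0, hne, -⟩
    have hD : HasFDerivAt (fun z : ℝ × ℝ => γ z.1 - γ z.2) _ (t, s) :=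
      ((hF.hasDerivAt t ht).hasFDerivAt.comp (t, s) hasFDerivAt_fst).sub
        ((hF.hasDerivAt s hs).hasFDerivAt.comp (t, s) hasFDerivAt_snd)
    have hev := hD.eventually_ne (c := 0) ?_
    · rw [← Filter.empty_mem_iff_bot, Filter.mem_inf_principal]
      filter_upwards [hev] with z hz hzS
      exact hz (sub_eq_zero.mpr hzS.2.2.2.2.2.symm)
    -- At distinct parameters the normals are independent and the speeds nonzero, so the
    -- differential of `γ t - γ s` is injective. Such pairs are thus isolated, and a discrete subset
    -- of the plane is countable.
    · have hker : LinearMap.ker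
          (((ContinuousLinearMap.toSpanSingleton ℝ (h t • rot (p + t • v))).comp
            (ContinuousLinearMap.fst ℝ ℝ ℝ) -
          (ContinuousLinearMap.toSpanSingleton ℝ (h s • rot (p + s • v))).comp
            (ContinuousLinearMap.snd ℝ ℝ ℝ)) : ℝ × ℝ →L[ℝ] (Fin 2 → ℝ)).toLinearMap = ⊥ := by
        rw [LinearMap.ker_eq_bot']
        rintro ⟨x, y⟩ hxy
        have e0 := congrFun hxy 0
        have e1 := congrFun hxy 1
        have hc := hF.cross_normal t s
        simp only [cross, Pi.add_apply, Pi.smul_apply, smul_eq_mul] at hc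
        simp [rot] at e0 e1
        have hst : s - t ≠ 0 := sub_ne_zero.mpr hne
        have hx : x * h t * (s - t) = 0 := by
          rw [← hc]; linear_combination (p 0 + s * v 0) * e0 + (p 1 + s * v 1) * e1
        have hy : y * h s * (s - t) = 0 := by
          rw [← hc]; linear_combination (p 0 + t * v 0) * e0 + (p 1 + t * v 1) * e1
        simp only [mul_eq_zero, hst, ht0, hs0, or_false] at hx hy
        rw [hx, hy]; rfl
      obtain ⟨K, -, hK⟩ := LinearMap.exists_antilipschitzWith _ hker
      exact ⟨K, hK⟩
  have hSc : S.Countable := 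
    Set.countable_coe_iff.mp (TopologicalSpace.separableSpace_iff_countable.mp inferInstance)
  refine (hSc.image Prod.fst).mono ?_
  rintro t ⟨ht, ht0, s, hs, hs0, hne, e⟩
  exact ⟨(t, s), ⟨ht, hs, ht0, hs0, hne, e⟩, rfl⟩

end IsFront

end Fronts

/-! ### Chambers, and the local structure of the plane near a front. -/

theorem IsChamber.eq_connectedComponentIn {Γ C : Set (Fin 2 → ℝ)} (hC : IsChamber Γ C)
    {x : Fin 2 → ℝ} (hx : x ∈ C) : C = connectedComponentIn Γᶜ x := by
  obtain ⟨p, -, rfl⟩ := hC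
  exact connectedComponentIn_eq hx

theorem IsChamber.subset_compl {Γ C : Set (Fin 2 → ℝ)} (hC : IsChamber Γ C) : C ⊆ Γᶜ := by
  obtain ⟨p, -, rfl⟩ := hC
  exact connectedComponentIn_subset _ _

theorem IsChamber.eq_of_mem {Γ C D : Set (Fin 2 → ℝ)} (hC : IsChamber Γ C) (hD : IsChamber Γ D)
    {x : Fin 2 → ℝ} (hx : x ∈ C) (hx' : x ∈ D) : C = D :=
  (hC.eq_connectedComponentIn hx).trans (hD.eq_connectedComponentIn hx').symm

theorem isPreconnected_image_add_smul (x d : Fin 2 → ℝ) {s : Set ℝ} (hs : s.OrdConnected) :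
    IsPreconnected ((fun r : ℝ => x + r • d) '' s) :=
  hs.isPreconnected.image _ (by fun_prop)

namespace IsFront

variable {a b : ℝ} {γ : ℝ → Fin 2 → ℝ} {h : ℝ → ℝ} {p v : Fin 2 → ℝ}

/-- Near `y` only a compact piece of the parameter interval matters; the image of its part outside
`T` is compact and misses `y`. With `T` empty this makes the complement of the curve a neighbourhood
of `y`; with `T` a small interval it isolates a single branch. -/
theorem exists_dist_lt_imp_mem (hF : IsFront a b γ h p v) {y : Fin 2 → ℝ}
    (hy : ∃ u w, Icc u w ⊆ Ioo a b ∧ ∃ δ > 0, ∀ t ∈ Ioo a b, dist (γ t) y < δ → t ∈ Icc u w)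
    {T : Set ℝ} (hT : IsOpen T) (hyT : ∀ t ∈ Ioo a b, γ t = y → t ∈ T) :
    ∃ δ > 0, ∀ t ∈ Ioo a b, dist (γ t) y < δ → t ∈ T := by
  obtain ⟨u, w, hsub, δ, hδ, H⟩ := hy
  have hK : IsCompact (γ '' (Icc u w \ T)) :=
    (isCompact_Icc.diff hT).image_of_continuousOn
      (hF.continuousOn.mono (sdiff_subset.trans hsub))
  have hyK : y ∈ (γ '' (Icc u w \ T))ᶜ := by
    rintro ⟨t, ⟨ht, htT⟩, e⟩
    exact htT (hyT t (hsub ht) e)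
  obtain ⟨ρ, hρ, hb⟩ := Metric.isOpen_iff.mp hK.isClosed.isOpen_compl y hyK
  refine ⟨min δ ρ, lt_min hδ hρ, fun t ht hd => ?_⟩
  by_contra htT
  exact hb (hd.trans_le (min_le_right _ _))
    ⟨t, ⟨H t ht (hd.trans_le (min_le_left _ _)), htT⟩, rfl⟩

theorem exists_ball_subset_compl (hF : IsFront a b γ h p v) {y : Fin 2 → ℝ}
    (hy : ∃ u w, Icc u w ⊆ Ioo a b ∧ ∃ δ > 0, ∀ t ∈ Ioo a b, dist (γ t) y < δ → t ∈ Icc u w)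
    (hyΓ : y ∉ γ '' Ioo a b) : ∃ δ > 0, Metric.ball y δ ⊆ (γ '' Ioo a b)ᶜ := by
  obtain ⟨δ, hδ, H⟩ := hF.exists_dist_lt_imp_mem hy isOpen_empty
    (fun t ht e => hyΓ ⟨t, ht, e⟩)
  refine ⟨δ, hδ, ?_⟩
  rintro _ hb ⟨t, ht, rfl⟩
  exact H t ht hb

/-- Every chamber contains points off any given finite set of lines of direction `d`. -/
theorem exists_mem_component_cross_notMem (hF : IsFront a b γ h p v)
    (hZ : {t | t ∈ Ioo a b ∧ h t = 0}.Finite) {d : Fin 2 → ℝ} (hd : d ≠ 0)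
    (hlev : ∀ c, {t | t ∈ Ioo a b ∧ cross d (γ t) = c}.Finite) {F : Set ℝ} (hFin : F.Finite)
    {x : Fin 2 → ℝ} (hx : x ∉ γ '' Ioo a b) :
    ∃ y ∈ connectedComponentIn (γ '' Ioo a b)ᶜ x, cross d y ∉ F := by
  obtain ⟨Q, hQ, hproper⟩ := hF.exists_finite_ends hZ
  have hinj : Function.Injective (fun s : ℝ => x + s • d) := fun s s' e =>
    smul_left_injective ℝ hd (add_left_cancel e)
  -- The given point may lie in `Q`, where the chamber need not be open. A short move along `d`
  -- escapes `Q` within the chamber; a ball is then available, and a move along `rot d` escapes the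
  -- finitely many lines.
  have hbad : {s : ℝ | x + s • d ∈ γ '' Ioo a b ∪ Q}.Finite := by
    refine ((((hlev (cross d x)).image γ).union hQ).preimage hinj.injOn).subset ?_
    rintro s (⟨t, ht, e⟩ | hs)
    · refine Or.inl ⟨t, ⟨ht, ?_⟩, e⟩
      rw [e, cross_add_smul]
    · exact Or.inr hs
  obtain ⟨s, hs, hsbad⟩ : ∃ s > (0 : ℝ), ∀ r ∈ Ioc 0 s, x + r • d ∉ γ '' Ioo a b ∪ Q := by
    have h2 : ∀ᶠ c in 𝓝[>] (0 : ℝ),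
        ∀ z ∈ {s : ℝ | x + s • d ∈ γ '' Ioo a b ∪ Q}, 0 < z → c < z :=
      (hbad.eventually_all).mpr fun z _ => by
        by_cases hz : 0 < z
        · filter_upwards [Ioo_mem_nhdsGT hz] with c hc _ using hc.2
        · exact Eventually.of_forall fun c hz' => absurd hz' hz
    obtain ⟨s, h2, hs⟩ := (h2.and self_mem_nhdsWithin).exists
    exact ⟨s, hs, fun r hr hmem => (h2 r hmem hr.1).not_ge hr.2⟩
  have hs' := hsbad s ⟨hs, le_rfl⟩
  have hseg : x + s • d ∈ connectedComponentIn (γ '' Ioo a b)ᶜ x := by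
    refine (isPreconnected_image_add_smul x d (ordConnected_Icc (a := 0) (b := s))
      ).subset_connectedComponentIn ⟨0, ⟨le_rfl, hs.le⟩, by simp⟩ ?_ ⟨s, ⟨hs.le, le_rfl⟩, rfl⟩
    rintro _ ⟨r, hr, rfl⟩
    rcases hr.1.eq_or_lt with rfl | hpos
    · simpa using hx
    · exact fun hmem => hsbad r ⟨hpos, hr.2⟩ (Or.inl hmem)
  obtain ⟨δ, hδ, hb⟩ := hF.exists_ball_subset_compl
    (hproper _ fun hmem => hs' (Or.inr hmem)) (fun hmem => hs' (Or.inl hmem))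
  have hev : ∀ᶠ u in 𝓝[>] (0 : ℝ), x + s • d + u • rot d ∈ Metric.ball (x + s • d) δ := by
    apply Filter.Tendsto.eventually_mem (l₂ := 𝓝 (x + s • d)) _ (Metric.ball_mem_nhds _ hδ)
    have : ContinuousAt (fun u : ℝ => x + s • d + u • rot d) 0 := by fun_prop
    simpa using this.tendsto.mono_left nhdsWithin_le_nhds
  have hfreq : ∃ᶠ u in 𝓝[>] (0 : ℝ), cross d (x + s • d + u • rot d) ∉ F := by
    have hfin : {u : ℝ | cross d (x + s • d + u • rot d) ∈ F}.Finite := by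
      refine hFin.preimage (f := fun u : ℝ => cross d (x + s • d + u • rot d)) ?_
      intro u _ u' _ e
      simp only [cross_add_smul_rot] at e
      exact mul_right_cancel₀ (dotProduct_self_pos hd).ne' (add_left_cancel e)
    intro hcon
    have hmem : {u : ℝ | cross d (x + s • d + u • rot d) ∈ F} ∈ 𝓝[>] (0 : ℝ) := by
      filter_upwards [hcon] with u hu
      exact not_not.mp hu
    obtain ⟨u, hu, hsub⟩ := mem_nhdsGT_iff_exists_Ioo_subset.mp hmem
    exact (Ioo_infinite hu) (hfin.subset hsub)
  obtain ⟨u, hu1, hu2⟩ := (hfreq.and_eventually hev).exists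
  refine ⟨_, ?_, hu1⟩
  rw [connectedComponentIn_eq hseg]
  exact (convex_ball _ _).isPreconnected.subset_connectedComponentIn
    (Metric.mem_ball_self hδ) hb hu2

/-- At a point of the front through which only one branch passes, transversally to `d`, the line
of direction `d` leads from one to the other of the two chambers that meet there. -/
theorem exists_local_crossing (hF : IsFront a b γ h p v) {d : Fin 2 → ℝ} (hd : d ≠ 0) {t₀ : ℝ}
    (ht₀ : t₀ ∈ Ioo a b) (hw : h t₀ * (d ⬝ᵥ (p + t₀ • v)) ≠ 0)
    (hproper : ∃ u w, Icc u w ⊆ Ioo a b ∧ ∃ δ > 0,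
      ∀ t ∈ Ioo a b, dist (γ t) (γ t₀) < δ → t ∈ Icc u w)
    (hinj : ∀ t ∈ Ioo a b, γ t = γ t₀ → t = t₀) {C D : Set (Fin 2 → ℝ)}
    (hC : IsChamber (γ '' Ioo a b) C) (hD : IsChamber (γ '' Ioo a b) D) (hCD : C ≠ D)
    (hyC : γ t₀ ∈ closure C) (hyD : γ t₀ ∈ closure D) :
    ∃ η : ℝ, η ≠ 0 ∧ γ t₀ + η • d ∈ C ∧ γ t₀ + (-η) • d ∈ D ∧
      ∀ t ∈ Ioo a b, ∀ s : ℝ, |s| ≤ |η| → γ t = γ t₀ + s • d → t = t₀ := by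
  obtain ⟨r, hr, hrsub⟩ : ∃ r > 0, Icc (t₀ - r) (t₀ + r) ⊆
      {t | t ∈ Ioo a b ∧ h t * (d ⬝ᵥ (p + t • v)) ≠ 0} := by
    have hmem : {t | t ∈ Ioo a b ∧ h t * (d ⬝ᵥ (p + t • v)) ≠ 0} ∈ 𝓝 t₀ :=
      inter_mem (isOpen_Ioo.mem_nhds ht₀)
        (((hF.continuousOn_deriv_cross d).continuousAt (isOpen_Ioo.mem_nhds ht₀)).eventually_ne
          hw)
    obtain ⟨r, hr, hb⟩ := Metric.nhds_basis_closedBall.mem_iff.mp hmem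
    rw [Real.closedBall_eq_Icc] at hb
    exact ⟨r, hr, hb⟩
  have hsub : Icc (t₀ - r) (t₀ + r) ⊆ Ioo a b := fun t ht => (hrsub ht).1
  have hinjT : InjOn (fun t => cross d (γ t)) (Icc (t₀ - r) (t₀ + r)) :=
    hF.injOn_cross ordConnected_Icc hsub fun t ht => (hrsub ht).2
  obtain ⟨δ, hδ, Hδ'⟩ := hF.exists_dist_lt_imp_mem hproper
    (isOpen_Ioo (a := t₀ - r) (b := t₀ + r))
    (fun t ht e => by rw [hinj t ht e]; exact ⟨by linarith, by linarith⟩)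
  have Hδ : ∀ t ∈ Ioo a b, dist (γ t) (γ t₀) < δ → t ∈ Icc (t₀ - r) (t₀ + r) :=
    fun t ht hdist => Ioo_subset_Icc_self (Hδ' t ht hdist)
  -- Box coordinates around `γ t₀`: `s` runs along `d`, and `u` labels the parallel lines. Since
  -- `cross d ∘ γ` is injective near `t₀`, each such line meets the curve at most once inside the
  -- box.
  set φ : ℝ → ℝ → Fin 2 → ℝ := fun s u => γ t₀ + s • d + u • rot d with hφ
  have hφ0 : ∀ s, φ s 0 = γ t₀ + s • d := fun s => by simp [hφ]
  have hφcross : ∀ s u, cross d (φ s u) = cross d (γ t₀) + u * (d ⬝ᵥ d) := fun s u => by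
    rw [hφ, cross_add_smul_rot, cross_add_smul]
  have hφinj : ∀ u s s', φ s u = φ s' u → s = s' := fun u s s' e =>
    smul_left_injective ℝ hd (add_left_cancel (add_right_cancel e))
  obtain ⟨η, hη, Hη⟩ : ∃ η > 0, ∀ s u, |s| ≤ η → |u| ≤ η → dist (φ s u) (γ t₀) < δ := by
    have hcont : ContinuousAt (fun z : ℝ × ℝ => φ z.1 z.2) 0 := by
      simp only [hφ]; fun_prop
    have hmem : {z : ℝ × ℝ | dist (φ z.1 z.2) (γ t₀) < δ} ∈ 𝓝 (0 : ℝ × ℝ) := by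
      apply hcont.preimage_mem_nhds (t := Metric.ball (γ t₀) δ)
      simpa [hφ] using Metric.ball_mem_nhds _ hδ
    obtain ⟨η, hη, hb⟩ := Metric.nhds_basis_closedBall.mem_iff.mp hmem
    refine ⟨η, hη, fun s u hs hu => @hb (s, u) ?_⟩
    rw [mem_closedBall_zero_iff, Prod.norm_def]
    exact max_le hs hu
  have huniq : ∀ u, |u| ≤ η → ∀ s₁ s₂, |s₁| ≤ η → |s₂| ≤ η → ∀ t₁ ∈ Ioo a b, ∀ t₂ ∈ Ioo a b,
      γ t₁ = φ s₁ u → γ t₂ = φ s₂ u → t₁ = t₂ := by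
    intro u hu s₁ s₂ hs₁ hs₂ t₁ ht₁ t₂ ht₂ e₁ e₂
    refine hinjT (Hδ t₁ ht₁ (e₁ ▸ Hη s₁ u hs₁ hu)) (Hδ t₂ ht₂ (e₂ ▸ Hη s₂ u hs₂ hu)) ?_
    simp only [e₁, e₂, hφcross]
  have honly : ∀ t ∈ Ioo a b, ∀ s : ℝ, |s| ≤ η → γ t = γ t₀ + s • d → t = t₀ := by
    intro t ht s hs e
    refine huniq 0 (by simpa using hη.le) s 0 hs (by simpa using hη.le) t ht t₀ ht₀ ?_ ?_
    · rw [hφ0, e]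
    · rw [hφ0]; simp
  have hend : ∀ σ : ℝ, |σ| = η → ∃ ρ > 0,
      Metric.ball (φ σ 0) ρ ⊆ (γ '' Ioo a b)ᶜ := by
    intro σ hσ
    apply hF.exists_ball_subset_compl
    · refine ⟨_, _, hsub, δ - dist (φ σ 0) (γ t₀),
        sub_pos.mpr (Hη σ 0 hσ.le (by simpa using hη.le)), fun t ht hdist => Hδ t ht ?_⟩
      linarith [dist_triangle (γ t) (φ σ 0) (γ t₀)]
    · rintro ⟨t, ht, e⟩
      have htt := honly t ht σ hσ.le (e.trans (hφ0 σ))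
      have : φ 0 0 = φ σ 0 := by rw [← e, htt, hφ0]; simp
      have := hφinj 0 _ _ this
      rw [← this, abs_zero] at hσ
      exact hη.ne hσ
  have hstrip : ∃ η' > 0, η' ≤ η ∧ ∀ u, |u| < η' → ∀ σ, σ = η ∨ σ = -η →
      φ σ 0 ∈ connectedComponentIn (γ '' Ioo a b)ᶜ (φ σ u) := by
    have hone : ∀ σ, |σ| = η → ∃ η' > 0, ∀ u, |u| < η' →
        φ σ 0 ∈ connectedComponentIn (γ '' Ioo a b)ᶜ (φ σ u) := by
      intro σ hσ
      obtain ⟨ρ, hρ, hb⟩ := hend σ hσ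
      have hcont : ContinuousAt (fun u : ℝ => φ σ u) 0 := by simp only [hφ]; fun_prop
      obtain ⟨η', hη', H⟩ := Metric.continuousAt_iff.mp hcont ρ hρ
      refine ⟨η', hη', fun u hu => ?_⟩
      exact (convex_ball _ _).isPreconnected.subset_connectedComponentIn
        (H (by simpa using hu)) hb (Metric.mem_ball_self hρ)
    obtain ⟨η₁, hη₁, H₁⟩ := hone η (abs_of_pos hη)
    obtain ⟨η₂, hη₂, H₂⟩ := hone (-η) (by rw [abs_neg, abs_of_pos hη])
    refine ⟨min η (min η₁ η₂), lt_min hη (lt_min hη₁ hη₂), min_le_left _ _, ?_⟩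
    rintro u hu σ (rfl | rfl)
    · exact H₁ u (hu.trans_le ((min_le_right _ _).trans (min_le_left _ _)))
    · exact H₂ u (hu.trans_le ((min_le_right _ _).trans (min_le_right _ _)))
  obtain ⟨η', hη', hη'le, Hη'⟩ := hstrip
  -- The line through a point off the curve has at most one hit in the box, so sliding along `d` is
  -- unobstructed in at least one sense. Near the ends `φ η 0` and `φ (-η) 0` the complement
  -- contains balls, which join the slid point to the end. Hence each chamber accumulating at `γ t₀`
  -- contains one of the two ends.
  have hside : ∀ s u, |s| < η → |u| < η' → φ s u ∈ (γ '' Ioo a b)ᶜ →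
      φ η 0 ∈ connectedComponentIn (γ '' Ioo a b)ᶜ (φ s u) ∨
      φ (-η) 0 ∈ connectedComponentIn (γ '' Ioo a b)ᶜ (φ s u) := by
    intro s u hs hu hmem
    have hs' := abs_lt.mp hs
    have hline : ∀ r, φ r u = (γ t₀ + u • rot d) + r • d := fun r => by
      simp only [hφ]; abel
    have hgo : ∀ σ, σ = η ∨ σ = -η → (∀ r ∈ uIcc s σ, φ r u ∈ (γ '' Ioo a b)ᶜ) →
        φ σ 0 ∈ connectedComponentIn (γ '' Ioo a b)ᶜ (φ s u) := by
      intro σ hσ hfree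
      have h1 : φ σ u ∈ connectedComponentIn (γ '' Ioo a b)ᶜ (φ s u) := by
        refine (isPreconnected_image_add_smul (γ t₀ + u • rot d) d
          (ordConnected_uIcc (a := s) (b := σ))).subset_connectedComponentIn
          ⟨s, left_mem_uIcc, (hline s).symm⟩ ?_ ⟨σ, right_mem_uIcc, (hline σ).symm⟩
        rintro _ ⟨r, hr, rfl⟩
        simp only [← hline]
        exact hfree r hr
      rw [connectedComponentIn_eq h1]
      exact Hη' u hu σ hσ
    by_cases hup : ∀ r ∈ uIcc s η, φ r u ∈ (γ '' Ioo a b)ᶜ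
    · exact Or.inl (hgo η (Or.inl rfl) hup)
    refine Or.inr (hgo (-η) (Or.inr rfl) fun r hr hmem' => ?_)
    push Not at hup
    obtain ⟨r', hr', hmem''⟩ := hup
    rw [uIcc_of_le hs'.2.le] at hr'
    rw [uIcc_of_ge hs'.1.le] at hr
    obtain ⟨t₁, ht₁, e₁⟩ := hmem'
    obtain ⟨t₂, ht₂, e₂⟩ := not_not.mp hmem''
    have htt := huniq u (hu.le.trans hη'le) r r'
      (abs_le.mpr ⟨hr.1, by linarith [hr.2]⟩) (abs_le.mpr ⟨by linarith [hr'.1], hr'.2⟩)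
      t₁ ht₁ t₂ ht₂ e₁ e₂
    have hrr : r = r' := hφinj u _ _ (by rw [← e₁, ← e₂, htt])
    have : r = s := le_antisymm hr.2 (hrr ▸ hr'.1)
    exact hmem ⟨t₁, ht₁, by rw [e₁, this]⟩
  have hmeet : ∀ E : Set (Fin 2 → ℝ), IsChamber (γ '' Ioo a b) E → γ t₀ ∈ closure E →
      φ η 0 ∈ E ∨ φ (-η) 0 ∈ E := by
    intro E hE hyE
    have hdd := dotProduct_self_pos hd
    have hopen : IsOpen {y : Fin 2 → ℝ | |d ⬝ᵥ (y - γ t₀) / (d ⬝ᵥ d)| < η ∧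
        |cross d (y - γ t₀) / (d ⬝ᵥ d)| < η'} := by
      refine IsOpen.and (isOpen_lt ?_ continuous_const) (isOpen_lt ?_ continuous_const)
      · simp only [dotProduct, Fin.sum_univ_two, Pi.sub_apply]; fun_prop
      · simp only [cross, Pi.sub_apply]; fun_prop
    obtain ⟨y, ⟨hy1, hy2⟩, hyE⟩ := mem_closure_iff.mp hyE _ hopen
      (by simpa [cross] using And.intro hη hη')
    have hyφ := eq_add_smul_add_smul_rot hd (γ t₀) y
    have hφy : φ (d ⬝ᵥ (y - γ t₀) / (d ⬝ᵥ d)) (cross d (y - γ t₀) / (d ⬝ᵥ d)) = y := hyφ.symm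
    have := hside _ _ hy1 hy2 (by rw [hφy]; exact hE.subset_compl hyE)
    rwa [hφy, ← hE.eq_connectedComponentIn hyE] at this
  simp only [hφ0] at hmeet
  rcases hmeet C hC hyC with h1 | h1 <;> rcases hmeet D hD hyD with h2 | h2
  · exact absurd (hC.eq_of_mem hD h1 h2) hCD
  · exact ⟨η, hη.ne', h1, h2, by rwa [abs_of_pos hη]⟩
  · exact ⟨-η, neg_ne_zero.mpr hη.ne', h1, by rwa [neg_neg], by rwa [abs_neg, abs_of_pos hη]⟩
  · exact absurd (hC.eq_of_mem hD h1 h2) hCD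

end IsFront

/-! ### The Horn–Kapranov parametrization and its Jacobian. -/

section HornKapranov

variable {n : ℕ} {A : Fin (n + 3) → Fin n → ℝ} {B : Matrix (Fin (n + 3)) (Fin 2) ℝ}
  {ε : Fin (n + 3) → SignType}

theorem mem_ker_hat_iff {u : Fin (n + 3) → ℝ} :
    u ∈ LinearMap.ker (hat A).mulVecLin ↔ ∑ i, u i = 0 ∧ ∀ k, ∑ i, A i k * u i = 0 := by
  rw [LinearMap.mem_ker, Matrix.mulVecLin_apply, funext_iff, Fin.forall_fin_succ]
  simp [hat, Matrix.mulVec, dotProduct]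

namespace IsGaleDual

theorem range_mulVecLin (hB : IsGaleDual A B) :
    LinearMap.range B.mulVecLin = LinearMap.ker (hat A).mulVecLin := by
  rw [Matrix.range_mulVecLin]
  exact hB.2

theorem injective_mulVec (hB : IsGaleDual A B) : Function.Injective B.mulVec :=
  Matrix.mulVec_injective_iff.mpr hB.1

theorem mulVec_mem_ker (hB : IsGaleDual A B) (l : Fin 2 → ℝ) :
    B *ᵥ l ∈ LinearMap.ker (hat A).mulVecLin := by
  rw [← hB.range_mulVecLin]
  exact ⟨l, rfl⟩

theorem sum_col (hB : IsGaleDual A B) (j : Fin 2) : ∑ i, B i j = 0 := by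
  have := (mem_ker_hat_iff.mp (hB.mulVec_mem_ker (Pi.single j 1))).1
  simpa using this

theorem sum_mul_col (hB : IsGaleDual A B) (k : Fin n) (j : Fin 2) : ∑ i, A i k * B i j = 0 := by
  have := (mem_ker_hat_iff.mp (hB.mulVec_mem_ker (Pi.single j 1))).2 k
  simpa using this

theorem sum_col_mul_dotProduct (hB : IsGaleDual A B) (x : Fin n → ℝ) (j : Fin 2) :
    ∑ i, B i j * (A i ⬝ᵥ x) = 0 := by
  calc ∑ i, B i j * (A i ⬝ᵥ x) = ∑ i, ∑ k, x k * (A i k * B i j) := by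
        refine Finset.sum_congr rfl fun i _ => ?_
        rw [dotProduct, Finset.mul_sum]
        exact Finset.sum_congr rfl fun k _ => by ring
    _ = 0 := by
        rw [Finset.sum_comm]
        refine Finset.sum_eq_zero fun k _ => ?_
        rw [← Finset.mul_sum, hB.sum_mul_col, mul_zero]

end IsGaleDual

theorem logMap_apply {N : ℕ} (B : Matrix (Fin N) (Fin 2) ℝ) (c : Fin N → ℝ) (j : Fin 2) :
    logMap B c j = ∑ i, B i j * Real.log |c i| := by
  simp [logMap, Matrix.mulVec, dotProduct]

theorem ne_zero_of_mem_orthant {N : ℕ} {ε : Fin N → SignType} (hε : ∀ i, ε i ≠ 0)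
    {c : Fin N → ℝ} (hc : c ∈ orthant ε) (i : Fin N) : c i ≠ 0 := by
  intro h0
  apply hε i
  rw [← hc i, h0, sign_zero]

theorem smul_mem_orthant {N : ℕ} {ε : Fin N → SignType} {c : Fin N → ℝ} (hc : c ∈ orthant ε)
    {r : ℝ} (hr : 0 < r) : r • c ∈ orthant ε := by
  intro i
  rw [Pi.smul_apply, smul_eq_mul, sign_mul, sign_pos hr, one_mul, hc i]

theorem smul_mem_cone {N : ℕ} {B : Matrix (Fin N) (Fin 2) ℝ} {ε : Fin N → SignType}
    {l : Fin 2 → ℝ} (hl : l ∈ cone B ε) {r : ℝ} (hr : 0 < r) : r • l ∈ cone B ε := by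
  show B *ᵥ (r • l) ∈ orthant ε
  rw [Matrix.mulVec_smul]
  exact smul_mem_orthant hl hr

/-- The Horn–Kapranov map is constant along rays. -/
theorem xi_smul (hB : IsGaleDual A B) (hε : ∀ i, ε i ≠ 0) {l : Fin 2 → ℝ} (hl : l ∈ cone B ε)
    {r : ℝ} (hr : 0 < r) : xi B (r • l) = xi B l := by
  ext j
  simp only [xi, logMap_apply, Matrix.mulVec_smul, Pi.smul_apply, smul_eq_mul, abs_mul]
  have : ∀ i, B i j * Real.log (|r| * |(B *ᵥ l) i|) =
      Real.log |r| * B i j + B i j * Real.log |(B *ᵥ l) i| := fun i => by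
    rw [Real.log_mul (abs_ne_zero.mpr hr.ne')
      (abs_ne_zero.mpr (ne_zero_of_mem_orthant hε hl i))]
    ring
  simp only [this, Finset.sum_add_distrib, ← Finset.mul_sum, hB.sum_col, mul_zero, zero_add]

theorem exists_smul_mem_params (hε : ∀ i, ε i ≠ 0) {l : Fin 2 → ℝ} (hl : l ∈ cone B ε) :
    ∃ r > (0 : ℝ), r • l ∈ params B ε := by
  have hpos : 0 < ∑ i, |(B *ᵥ l) i| :=
    Finset.sum_pos (fun i _ => abs_pos.mpr (ne_zero_of_mem_orthant hε hl i))
      Finset.univ_nonempty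
  refine ⟨(∑ i, |(B *ᵥ l) i|)⁻¹, inv_pos.mpr hpos, smul_mem_cone hl (inv_pos.mpr hpos), ?_⟩
  simp only [Matrix.mulVec_smul, Pi.smul_apply, smul_eq_mul, abs_mul, ← Finset.mul_sum]
  rw [abs_of_pos (inv_pos.mpr hpos), inv_mul_cancel₀ hpos.ne']

theorem hasFDerivAt_expSum (A : Fin (n + 3) → Fin n → ℝ) (c : Fin (n + 3) → ℝ) (x : Fin n → ℝ) :
    HasFDerivAt (expSum A c) (∑ i, c i • (Real.exp (A i ⬝ᵥ x) •
      (LinearMap.toContinuousLinearMap (dotProductBilin ℝ ℝ (A i))))) x := by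
  unfold expSum
  refine HasFDerivAt.fun_sum fun i _ => ?_
  have : HasFDerivAt (fun y : Fin n → ℝ => A i ⬝ᵥ y)
      (LinearMap.toContinuousLinearMap (dotProductBilin ℝ ℝ (A i))) x :=
    (LinearMap.toContinuousLinearMap (dotProductBilin ℝ ℝ (A i))).hasFDerivAt
  exact this.exp.const_mul (c i)

/-- The value and the partial derivatives at `x` are the entries of `hat A` applied to the vector of
terms `c i * Real.exp (A i ⬝ᵥ x)`. -/
theorem isSingularZero_iff {c : Fin (n + 3) → ℝ} {x : Fin n → ℝ} :
    IsSingularZero (expSum A c) x ↔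
      (fun i => c i * Real.exp (A i ⬝ᵥ x)) ∈ LinearMap.ker (hat A).mulVecLin := by
  rw [mem_ker_hat_iff, IsSingularZero, (hasFDerivAt_expSum A c x).fderiv]
  refine and_congr Iff.rfl (forall_congr' fun k => ?_)
  simp only [sum_apply, smul_apply,
    LinearMap.coe_toContinuousLinearMap', dotProductBilin_apply_apply, dotProduct_single,
    smul_eq_mul, mul_one]
  simp only [mul_comm, mul_left_comm]

/-- The reduced discriminant curve is the image of the Horn–Kapranov map. -/
theorem curve_eq_image_params (hB : IsGaleDual A B) (hε : ∀ i, ε i ≠ 0) :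
    curve A B ε = xi B '' params B ε := by
  apply Subset.antisymm
  -- The vector of terms at the singular zero is `B *ᵥ l`. Passing from `c` to it adds `A i ⬝ᵥ x` to
  -- the logarithms, and this is killed by the transpose of `B`. Conversely `x = 0` is a singular
  -- zero for `c = B *ᵥ l`.
  · rintro _ ⟨c, ⟨hc, x, hx⟩, rfl⟩
    rw [isSingularZero_iff, ← hB.range_mulVecLin] at hx
    obtain ⟨l, hl⟩ := hx
    have hl' : ∀ i, (B *ᵥ l) i = c i * Real.exp (A i ⬝ᵥ x) := fun i => congrFun hl i
    have hcone : l ∈ cone B ε := fun i => by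
      rw [hl' i, sign_mul, sign_pos (Real.exp_pos _), mul_one, hc i]
    obtain ⟨r, hr, hmem⟩ := exists_smul_mem_params hε hcone
    refine ⟨_, hmem, ?_⟩
    rw [xi_smul hB hε hcone hr]
    ext j
    have : ∀ i, B i j * Real.log |(B *ᵥ l) i| =
        B i j * Real.log |c i| + B i j * (A i ⬝ᵥ x) := fun i => by
      rw [hl' i, abs_mul, Real.log_mul (abs_ne_zero.mpr (ne_zero_of_mem_orthant hε hc i))
        (abs_ne_zero.mpr (Real.exp_pos _).ne'), Real.abs_exp, Real.log_exp, mul_add]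
    rw [xi, logMap_apply, logMap_apply]
    simp only [this, Finset.sum_add_distrib, hB.sum_col_mul_dotProduct, add_zero]
  · rintro _ ⟨l, hl, rfl⟩
    refine ⟨B *ᵥ l, ⟨hl.1, 0, isSingularZero_iff.mpr ?_⟩, rfl⟩
    simpa using hB.mulVec_mem_ker l

/-- The Jacobian matrix of the Horn–Kapranov map. -/
noncomputable def xiJacobian {N : ℕ} (B : Matrix (Fin N) (Fin 2) ℝ) (l : Fin 2 → ℝ) :
    Matrix (Fin 2) (Fin 2) ℝ :=
  Matrix.of fun j k => ∑ i, B i j * B i k * ((B *ᵥ l) i)⁻¹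

theorem xiJacobian_mulVec {N : ℕ} (B : Matrix (Fin N) (Fin 2) ℝ) (l w : Fin 2 → ℝ) (j : Fin 2) :
    (xiJacobian B l *ᵥ w) j = ∑ i, B i j * (((B *ᵥ l) i)⁻¹ * (B *ᵥ w) i) := by
  simp only [xiJacobian, Matrix.mulVec, dotProduct, Matrix.of_apply, Fin.sum_univ_two,
    Finset.sum_mul, ← Finset.sum_add_distrib]
  exact Finset.sum_congr rfl fun i _ => by ring

theorem hasFDerivAt_xi {N : ℕ} {B : Matrix (Fin N) (Fin 2) ℝ} {l : Fin 2 → ℝ}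
    (hl : ∀ i, (B *ᵥ l) i ≠ 0) :
    HasFDerivAt (xi B) (LinearMap.toContinuousLinearMap (xiJacobian B l).mulVecLin) l := by
  rw [hasFDerivAt_pi']
  intro j
  have h1 : ∀ i, HasFDerivAt (fun y : Fin 2 → ℝ => (B *ᵥ y) i)
      (LinearMap.toContinuousLinearMap ((LinearMap.proj i).comp B.mulVecLin)) l := fun i =>
    (LinearMap.toContinuousLinearMap ((LinearMap.proj i).comp B.mulVecLin)).hasFDerivAt
  have h2 := HasFDerivAt.fun_sum (u := Finset.univ)
    fun i _ => ((h1 i).log (hl i)).const_mul (B i j)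
  have h3 : (fun y => xi B y j) = fun y => ∑ i, B i j * Real.log ((B *ᵥ y) i) := by
    funext y
    rw [xi, logMap_apply]
    simp only [Real.log_abs]
  rw [h3]
  refine h2.congr_fderiv ?_
  refine ContinuousLinearMap.ext fun w => ?_
  refine Eq.trans ?_ (xiJacobian_mulVec B l w j).symm
  simp

theorem xiJacobian_mulVec_self (hB : IsGaleDual A B) {l : Fin 2 → ℝ}
    (hl : ∀ i, (B *ᵥ l) i ≠ 0) : xiJacobian B l *ᵥ l = 0 := by
  ext j
  rw [xiJacobian_mulVec]
  simp only [inv_mul_cancel₀ (hl _), mul_one, hB.sum_col, Pi.zero_apply]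

/-- The Jacobian is symmetric and kills `l`, so its image is orthogonal to `l`, hence spanned by
`rot l`. The coefficient is read off by pairing with `v`, since `v ⬝ᵥ rot l = cross l v = 1`. -/
theorem xiJacobian_mulVec_of_cross_eq_one (hB : IsGaleDual A B) {l v : Fin 2 → ℝ}
    (hl : ∀ i, (B *ᵥ l) i ≠ 0) (hv : cross l v = 1) :
    xiJacobian B l *ᵥ v = (v ⬝ᵥ xiJacobian B l *ᵥ v) • rot l := by
  have h0 := congrFun (xiJacobian_mulVec_self hB hl) 0
  have h1 := congrFun (xiJacobian_mulVec_self hB hl) 1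
  have hs : xiJacobian B l 0 1 = xiJacobian B l 1 0 := by
    simp [xiJacobian, mul_comm]
  simp only [Matrix.mulVec, dotProduct, Fin.sum_univ_two, Pi.zero_apply] at h0 h1
  simp only [cross] at hv
  ext j
  fin_cases j <;> simp [Matrix.mulVec, dotProduct, rot]
  · linear_combination (-(xiJacobian B l 0 0 * v 0 + xiJacobian B l 0 1 * v 1)) * hv
      + v 0 * v 1 * h0 + v 1 ^ 2 * h1 + (l 0 * v 1 ^ 2 - v 0 * v 1 * l 1) * hs
  · linear_combination (-(xiJacobian B l 1 0 * v 0 + xiJacobian B l 1 1 * v 1)) * hv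
      - v 0 ^ 2 * h0 - v 1 * v 0 * h1 + (v 0 ^ 2 * l 1 - v 0 * v 1 * l 0) * hs

theorem mem_orthant_iff {N : ℕ} {ε : Fin N → SignType} (hε : ∀ i, ε i ≠ 0) {c : Fin N → ℝ} :
    c ∈ orthant ε ↔ ∀ i, 0 < (ε i : ℝ) * c i := by
  refine forall_congr' fun i => ?_
  rcases h : ε i with _ | _ | _
  · exact absurd h (hε i)
  · simp [sign_eq_neg_one_iff]
  · simp [sign_eq_one_iff]

theorem isOpen_cone {N : ℕ} (B : Matrix (Fin N) (Fin 2) ℝ) {ε : Fin N → SignType}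
    (hε : ∀ i, ε i ≠ 0) : IsOpen (cone B ε) := by
  have : cone B ε = ⋂ i, {l | 0 < (ε i : ℝ) * (B *ᵥ l) i} := by
    ext l
    simp [cone, mem_orthant_iff hε]
  rw [this]
  refine isOpen_iInter_of_finite fun i => isOpen_lt continuous_const ?_
  simp only [Matrix.mulVec, dotProduct, Fin.sum_univ_two]
  fun_prop

theorem convex_cone {N : ℕ} (B : Matrix (Fin N) (Fin 2) ℝ) {ε : Fin N → SignType}
    (hε : ∀ i, ε i ≠ 0) : Convex ℝ (cone B ε) := by
  intro x hx y hy s t hs ht hst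
  simp only [cone, mem_ofPred_eq, mem_orthant_iff hε] at hx hy ⊢
  intro i
  simp only [Matrix.mulVec_add, Matrix.mulVec_smul, Pi.add_apply, Pi.smul_apply, smul_eq_mul]
  have e : (ε i : ℝ) * (s * (B *ᵥ x) i + t * (B *ᵥ y) i) =
      s * ((ε i : ℝ) * (B *ᵥ x) i) + t * ((ε i : ℝ) * (B *ᵥ y) i) := by ring
  rw [e]
  rcases hs.eq_or_lt with rfl | hs
  · have : t = 1 := by linarith
    subst this
    simpa using hy i
  · exact add_pos_of_pos_of_nonneg (mul_pos hs (hx i)) (mul_nonneg ht (hy i).le)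

/-- On the cone the signs are fixed, so the sum of absolute values is linear in `l`. This exhibits
`params` as a slice of the cone by a line. -/
theorem mem_params_iff {N : ℕ} {B : Matrix (Fin N) (Fin 2) ℝ} {ε : Fin N → SignType}
    {l : Fin 2 → ℝ} :
    l ∈ params B ε ↔ l ∈ cone B ε ∧ ((fun i => (ε i : ℝ)) ᵥ* B) ⬝ᵥ l = 1 := by
  refine and_congr_right fun hl => ?_
  rw [← Matrix.dotProduct_mulVec, dotProduct]
  have : ∀ i, |(B *ᵥ l) i| = (ε i : ℝ) * (B *ᵥ l) i := fun i => by
    rw [← hl i, sign_mul_self]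
  simp only [this]

/-- The reduced discriminant curve is a front whose cusps are the cusps of the curve. -/
theorem exists_isFront (hB : IsGaleDual A B) (hε : ∀ i, ε i ≠ 0) (hne : (params B ε).Nonempty) :
    ∃ (a b : ℝ) (h : ℝ → ℝ) (p v : Fin 2 → ℝ), IsFront a b (fun t => xi B (p + t • v)) h p v ∧
      params B ε = (fun t : ℝ => p + t • v) '' Ioo a b ∧
      (∀ t ∈ Ioo a b, fderiv ℝ (xi B) (p + t • v) v = h t • rot (p + t • v)) ∧
      ∀ t ∈ Ioo a b, fderiv ℝ (xi B) (p + t • v) = 0 ↔ h t = 0 := by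
  obtain ⟨p, hp⟩ := hne
  have hp' := mem_params_iff.mp hp
  set σ : Fin 2 → ℝ := (fun i => (ε i : ℝ)) ᵥ* B with hσ
  set v : Fin 2 → ℝ := rot σ with hv
  have hσ0 : σ ≠ 0 := by
    intro e
    have := hp'.2
    rw [e, zero_dotProduct] at this
    exact zero_ne_one this
  have hσv : σ ⬝ᵥ v = 0 := by simp [hv, rot, dotProduct]; ring
  have hσt : ∀ t : ℝ, σ ⬝ᵥ (p + t • v) = 1 := fun t => by
    rw [dotProduct_add, dotProduct_smul, hσv, hp'.2]; simp
  have hv0 : v ≠ 0 := by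
    intro e
    apply hσ0
    ext i
    fin_cases i
    · simpa [hv, rot] using congrFun e 1
    · simpa [hv, rot] using congrFun e 0
  have hcross : ∀ t : ℝ, cross (p + t • v) v = 1 := fun t => by
    rw [hv, cross_rot, dotProduct_comm, ← hv, hσt]
  set I : Set ℝ := {t | p + t • v ∈ cone B ε} with hI
  have hIparams : ∀ t ∈ I, p + t • v ∈ params B ε := fun t ht => mem_params_iff.mpr ⟨ht, hσt t⟩
  have hIopen : IsOpen I := (isOpen_cone B hε).preimage (by fun_prop)
  have hI0 : (0 : ℝ) ∈ I := by simpa [hI] using hp'.1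
  have hIconv : Convex ℝ I := by
    have hpre : I = AffineMap.lineMap (k := ℝ) p (p + v) ⁻¹' cone B ε := by
      ext t
      simp [hI, AffineMap.lineMap_apply, add_comm]
    rw [hpre]
    exact (convex_cone B hε).affine_preimage _
  obtain ⟨i, hi⟩ : ∃ i, (B *ᵥ v) i ≠ 0 := by
    by_contra! h0
    exact hv0 (hB.injective_mulVec (by rw [Matrix.mulVec_zero]; exact funext h0))
  -- The normalization bounds each entry of `B *ᵥ (p + t • v)` by 1, and entry `i` has nonzero slope
  -- in `t`.
  have hbound : ∀ t ∈ I, |t| ≤ (1 + |(B *ᵥ p) i|) / |(B *ᵥ v) i| := by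
    intro t ht
    rw [le_div_iff₀ (abs_pos.mpr hi), ← abs_mul]
    have h1 : |(B *ᵥ (p + t • v)) i| ≤ 1 := by
      rw [← (hIparams t ht).2]
      exact Finset.single_le_sum (f := fun i => |(B *ᵥ (p + t • v)) i|)
        (fun _ _ => abs_nonneg _) (Finset.mem_univ i)
    rw [Matrix.mulVec_add, Matrix.mulVec_smul] at h1
    have h2 : t * (B *ᵥ v) i = (B *ᵥ p + t • B *ᵥ v) i - (B *ᵥ p) i := by simp
    rw [h2]
    exact (abs_sub _ _).trans (by linarith)
  have hbb : BddBelow I := ⟨_, fun t ht => (abs_le.mp (hbound t ht)).1⟩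
  have hba : BddAbove I := ⟨_, fun t ht => (abs_le.mp (hbound t ht)).2⟩
  have hIeq : I = Ioo (sInf I) (sSup I) := by
    apply Subset.antisymm
    · rw [← interior_Icc]
      exact interior_maximal (fun t ht => ⟨csInf_le hbb ht, le_csSup hba ht⟩) hIopen
    · exact IsConnected.Ioo_csInf_csSup_subset ⟨⟨0, hI0⟩, hIconv.isPreconnected⟩ hbb hba
  have hIne : ∀ t ∈ I, ∀ i, (B *ᵥ (p + t • v)) i ≠ 0 := fun t ht =>
    ne_zero_of_mem_orthant hε ht
  have hfd : ∀ t ∈ I, fderiv ℝ (xi B) (p + t • v) =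
      LinearMap.toContinuousLinearMap (xiJacobian B (p + t • v)).mulVecLin := fun t ht =>
    (hasFDerivAt_xi (hIne t ht)).fderiv
  have hfdv : ∀ t ∈ I, fderiv ℝ (xi B) (p + t • v) v =
      (v ⬝ᵥ xiJacobian B (p + t • v) *ᵥ v) • rot (p + t • v) := fun t ht => by
    rw [hfd t ht]
    exact xiJacobian_mulVec_of_cross_eq_one hB (hIne t ht) (hcross t)
  refine ⟨sInf I, sSup I, fun t => v ⬝ᵥ xiJacobian B (p + t • v) *ᵥ v, p, v, ?_, ?_, ?_, ?_⟩
  · refine ⟨?_, ?_, ?_, by simpa using hcross 0⟩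
    · have := hI0
      rw [hIeq] at this
      exact this.1.trans this.2
    · rw [← hIeq]
      simp only [dotProduct, xiJacobian_mulVec]
      refine continuousOn_finsetSum _ fun j _ => continuousOn_const.mul
        (continuousOn_finsetSum _ fun i _ => continuousOn_const.mul
          (ContinuousOn.mul (ContinuousOn.inv₀ ?_ fun t ht => hIne t ht i) continuousOn_const))
      simp only [Matrix.mulVec, dotProduct, Fin.sum_univ_two, Pi.add_apply, Pi.smul_apply]
      fun_prop
    · rw [← hIeq]
      intro t ht
      rw [← hfdv t ht]
      have h1 : HasDerivAt (fun t : ℝ => p + t • v) v t := by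
        simpa using ((hasDerivAt_id t).smul_const v).const_add p
      exact (hasFDerivAt_xi (hIne t ht)).differentiableAt.hasFDerivAt.comp_hasDerivAt t h1
  · rw [← hIeq]
    apply Subset.antisymm
    · intro l hl
      have hl' := mem_params_iff.mp hl
      obtain ⟨t, ht⟩ : ∃ t : ℝ, l = p + t • v := by
        have hc : cross v l = cross v p := by
          have h1 := hl'.2.trans hp'.2.symm
          simp only [← hσ, dotProduct, Fin.sum_univ_two] at h1
          simp [cross, hv, rot]; linarith
        exact exists_eq_add_smul_of_cross_eq hv0 hc
      exact ⟨t, by rw [hI, mem_ofPred_eq, ← ht]; exact hl'.1, ht.symm⟩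
    · rintro _ ⟨t, ht, rfl⟩
      exact hIparams t ht
  · rw [← hIeq]
    exact hfdv
  · rw [← hIeq]
    intro t ht
    constructor
    · intro h0
      have := hfdv t ht
      rw [h0] at this
      have h2 := congrArg (v ⬝ᵥ ·) this
      have h3 : v ⬝ᵥ rot (p + t • v) = 1 := by
        rw [← hcross t]; simp [dotProduct, rot, cross]; ring
      simp only [dotProduct_smul, h3] at h2
      simpa using h2.symm
    · intro h0
      have h1 := hfdv t ht
      rw [show v ⬝ᵥ xiJacobian B (p + t • v) *ᵥ v = 0 from h0, zero_smul] at h1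
      have h2 : fderiv ℝ (xi B) (p + t • v) (p + t • v) = 0 := by
        rw [hfd t ht]
        exact xiJacobian_mulVec_self hB (hIne t ht)
      ext1 w
      -- The differential always vanishes along the ray, so its vanishing on `v`, which completes a
      -- basis, is enough.
      have hw : w = cross w v • (p + t • v) + cross (p + t • v) w • v := by
        have hc := hcross t
        ext i
        fin_cases i <;> simp [cross] at hc ⊢
        · linear_combination (-w 0) * hc
        · linear_combination (-w 1) * hc
      rw [hw, map_add, map_smul, map_smul, h1, h2]
      simp

end HornKapranov

/-! ### Depth bounds from transversal segments and rays. -/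

section Depth

variable {n : ℕ} {A : Fin (n + 3) → Fin n → ℝ} {B : Matrix (Fin (n + 3)) (Fin 2) ℝ}
  {ε : Fin (n + 3) → SignType}

theorem not_isBounded_of_ray {D : Set (Fin 2 → ℝ)} {x d : Fin 2 → ℝ} (hd : d ≠ 0) {S : ℝ}
    (hD : ∀ s, S ≤ s → x + s • d ∈ D) : ¬ Bornology.IsBounded D := by
  intro hb
  obtain ⟨M, hM⟩ := hb.exists_norm_le
  have hd' : 0 < ‖d‖ := norm_pos_iff.mpr hd
  set s := max S ((M + ‖x‖ + 1) / ‖d‖) with hs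
  have h1 := hM _ (hD s (le_max_left _ _))
  have h2 : (M + ‖x‖ + 1) / ‖d‖ ≤ s := le_max_right _ _
  rw [div_le_iff₀ hd'] at h2
  have h3 : ‖s • d‖ ≤ ‖x + s • d‖ + ‖x‖ := by
    simpa using norm_sub_le (x + s • d) x
  rw [norm_smul] at h3
  have h4 : s * ‖d‖ ≤ ‖s‖ * ‖d‖ := mul_le_mul_of_nonneg_right (le_abs_self s) hd'.le
  linarith

/-- A path that leads from a chamber to another one meets the curve. -/
theorem one_le_depth (hB : IsGaleDual A B) (hε : ∀ i, ε i ≠ 0) {C : Set (Fin 2 → ℝ)}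
    (hC : IsChamber (curve A B ε) C) (hout : ¬ IsOuter (curve A B ε) C) :
    1 ≤ depth A B ε C := by
  refine le_iInf fun α => le_iInf fun hα => le_iInf fun h0 => le_iInf fun h1 => ?_
  rw [Set.one_le_encard_iff_nonempty]
  by_contra hne
  rw [Set.not_nonempty_iff_eq_empty] at hne
  obtain ⟨D, hD, h1⟩ := h1
  have hsub : α '' Icc 0 1 ⊆ (curve A B ε)ᶜ := by
    rintro _ ⟨u, hu, rfl⟩ hmem
    rw [curve_eq_image_params hB hε] at hmem
    obtain ⟨l, hl, e⟩ := hmem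
    have : (u, l) ∈ crossings B ε α := ⟨hu, hl, e.symm⟩
    rw [hne] at this
    exact this
  have hmem : α 1 ∈ connectedComponentIn (curve A B ε)ᶜ (α 0) :=
    (isPreconnected_Icc.image α hα.1).subset_connectedComponentIn
      ⟨0, by simp, rfl⟩ hsub ⟨1, by simp, rfl⟩
  rw [← hC.eq_connectedComponentIn h0] at hmem
  exact hout (hC.eq_of_mem hD.1 hmem h1 ▸ hD)

theorem depth_le_encard_crossings {C D : Set (Fin 2 → ℝ)} {α : ℝ → Fin 2 → ℝ}
    (hα : IsTransversalPath B ε α) (h0 : α 0 ∈ C) (hD : IsOuter (curve A B ε) D)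
    (h1 : α 1 ∈ D) : depth A B ε C ≤ (crossings B ε α).encard :=
  iInf_le_of_le α (iInf_le_of_le hα (iInf_le_of_le h0 (iInf_le_of_le ⟨D, hD, h1⟩ le_rfl)))

theorem depth_eq_zero_of_isEmpty (hB : IsGaleDual A B) (hε : ∀ i, ε i ≠ 0)
    (he : params B ε = ∅) {C : Set (Fin 2 → ℝ)} (hC : IsChamber (curve A B ε) C) :
    depth A B ε C = 0 := by
  have hcurve : curve A B ε = ∅ := by rw [curve_eq_image_params hB hε, he, image_empty]
  have hno : ∀ α, crossings B ε α = ∅ := fun α =>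
    eq_empty_of_forall_notMem fun q hq => (he ▸ hq.2.1 : q.2 ∈ (∅ : Set (Fin 2 → ℝ)))
  have huniv : C = univ := by
    obtain ⟨x, -, rfl⟩ := hC
    rw [hcurve, compl_empty, connectedComponentIn_univ]
    exact PreconnectedSpace.connectedComponent_eq_univ x
  have hout : IsOuter (curve A B ε) C := by
    refine ⟨hC, not_isBounded_of_ray (x := 0) (d := 1) (S := 0) one_ne_zero fun s _ => ?_⟩
    rw [huniv]
    trivial
  have hpath : IsTransversalPath B ε fun _ => 0 :=
    ⟨continuousOn_const, fun q hq => ((hno _ ▸ hq : q ∈ (∅ : Set (ℝ × (Fin 2 → ℝ))))).elim⟩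
  have := depth_le_encard_crossings (A := A) (C := C) hpath (by rw [huniv]; trivial) hout
    (by rw [huniv]; trivial)
  rw [hno, encard_empty] at this
  exact nonpos_iff_eq_zero.mp this

theorem sup_range_eq_top_of_cross_ne_zero {f : (Fin 2 → ℝ) →L[ℝ] (Fin 2 → ℝ)}
    {d w : Fin 2 → ℝ} (hd : cross d (f w) ≠ 0) :
    Submodule.span ℝ {d} ⊔ LinearMap.range f.toLinearMap = ⊤ := by
  rw [eq_top_iff]
  intro y _
  refine Submodule.mem_sup.mpr ⟨(cross y (f w) / cross d (f w)) • d,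
    Submodule.smul_mem _ _ (Submodule.mem_span_singleton_self d),
    f ((cross d y / cross d (f w)) • w), ⟨_, rfl⟩, ?_⟩
  rw [map_smul]
  ext i
  apply mul_left_cancel₀ hd
  simp only [Pi.add_apply, Pi.smul_apply, smul_eq_mul, mul_add, div_mul_eq_mul_div,
    mul_div_cancel₀ _ hd]
  fin_cases i <;> simp [cross] <;> ring

variable {a b : ℝ} {h : ℝ → ℝ} {p v : Fin 2 → ℝ}

theorem curve_eq_image_Ioo (hB : IsGaleDual A B) (hε : ∀ i, ε i ≠ 0)
    (hP : params B ε = (fun t : ℝ => p + t • v) '' Ioo a b) :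
    curve A B ε = (fun t => xi B (p + t • v)) '' Ioo a b := by
  rw [curve_eq_image_params hB hε, hP, image_image]

/-- A crossing on a line is determined by its curve parameter: `cross p` recovers `t` from `p + t •
v`, and the time follows because `d ≠ 0`. -/
theorem encard_crossings_line_le (hF : IsFront a b (fun t => xi B (p + t • v)) h p v)
    (hP : params B ε = (fun t : ℝ => p + t • v) '' Ioo a b) (x : Fin 2 → ℝ) {d : Fin 2 → ℝ}
    (hd : d ≠ 0) : (crossings B ε fun u => x + u • d).encard ≤
      {t | t ∈ Ioo a b ∧ ∃ s ∈ Icc (0 : ℝ) 1, xi B (p + t • v) = x + s • d}.encard := by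
  have hcr : ∀ t : ℝ, cross p (p + t • v) = t := fun t => by
    simpa using hF.cross_normal 0 t
  refine Set.encard_le_encard_of_injOn (f := fun q => cross p q.2) ?_ ?_
  · rintro ⟨u, l⟩ ⟨hu, hl, e⟩
    rw [hP] at hl
    obtain ⟨t, ht, hl⟩ := hl
    simp only at hl hu e
    subst hl
    simp only [hcr]
    exact ⟨ht, u, hu, e.symm⟩
  · rintro ⟨u, l⟩ ⟨_, hl, e⟩ ⟨u', l'⟩ ⟨_, hl', e'⟩ heq
    rw [hP] at hl hl'
    obtain ⟨t, _, hl⟩ := hl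
    obtain ⟨t', _, hl'⟩ := hl'
    simp only at hl hl' e e'
    subst hl hl'
    simp only [hcr] at heq
    subst heq
    have := smul_left_injective ℝ hd (add_left_cancel (e.trans e'.symm))
    rw [this]

/-- The depth of a chamber is at most the number of intersections of a transversal segment that
leads to an outer chamber. -/
theorem depth_le_encard_segment (hF : IsFront a b (fun t => xi B (p + t • v)) h p v)
    (hP : params B ε = (fun t : ℝ => p + t • v) '' Ioo a b)
    (hfd : ∀ t ∈ Ioo a b, fderiv ℝ (xi B) (p + t • v) v = h t • rot (p + t • v))
    {C D : Set (Fin 2 → ℝ)} {x d : Fin 2 → ℝ} (hd : d ≠ 0) (hx : x ∈ C)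
    (hD : IsOuter (curve A B ε) D) (hxD : x + d ∈ D)
    (ht : ∀ t ∈ Ioo a b, ∀ s ∈ Icc (0 : ℝ) 1, xi B (p + t • v) = x + s • d →
      h t ≠ 0 ∧ d ⬝ᵥ (p + t • v) ≠ 0) :
    depth A B ε C ≤
      {t | t ∈ Ioo a b ∧ ∃ s ∈ Icc (0 : ℝ) 1, xi B (p + t • v) = x + s • d}.encard := by
  refine (depth_le_encard_crossings (α := fun u => x + u • d) ⟨by fun_prop, ?_⟩
    (by simpa using hx) hD (by simpa using hxD)).trans (encard_crossings_line_le hF hP x hd)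
  rintro ⟨u, l⟩ ⟨hu, hl, e⟩
  rw [hP] at hl
  obtain ⟨t, htI, hl⟩ := hl
  simp only at hl hu e
  subst hl
  obtain ⟨h0, hd0⟩ := ht t htI u hu e.symm
  refine ⟨d, ?_, ?_⟩
  · simpa using ((hasDerivAt_id u).smul_const d).const_add x
  · apply sup_range_eq_top_of_cross_ne_zero (w := v)
    rw [hfd t htI]
    have : cross d (h t • rot (p + t • v)) = h t * (d ⬝ᵥ (p + t • v)) := by
      rw [← cross_rot]; simp [cross]; ring
    rw [this]
    exact mul_ne_zero h0 hd0

/-- The depth of a chamber is at most the number of intersections of a transversal ray. -/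
theorem depth_le_encard_ray (hB : IsGaleDual A B) (hε : ∀ i, ε i ≠ 0)
    (hF : IsFront a b (fun t => xi B (p + t • v)) h p v)
    (hP : params B ε = (fun t : ℝ => p + t • v) '' Ioo a b)
    (hfd : ∀ t ∈ Ioo a b, fderiv ℝ (xi B) (p + t • v) v = h t • rot (p + t • v))
    {C : Set (Fin 2 → ℝ)} (hC : IsChamber (curve A B ε) C) {x d : Fin 2 → ℝ} (hd : d ≠ 0)
    (hx : x ∈ C)
    (hfin : {t | t ∈ Ioo a b ∧ ∃ s > (0 : ℝ), xi B (p + t • v) = x + s • d}.Finite)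
    (ht : ∀ t ∈ Ioo a b, ∀ s > (0 : ℝ), xi B (p + t • v) = x + s • d →
      h t ≠ 0 ∧ d ⬝ᵥ (p + t • v) ≠ 0) :
    depth A B ε C ≤
      {t | t ∈ Ioo a b ∧ ∃ s > (0 : ℝ), xi B (p + t • v) = x + s • d}.encard := by
  have hΓ := curve_eq_image_Ioo (A := A) hB hε hP
  have hinj : Function.Injective (fun s : ℝ => x + s • d) := fun s s' e =>
    smul_left_injective ℝ hd (add_left_cancel e)
  have hfinS : {s : ℝ | 0 < s ∧ x + s • d ∈ curve A B ε}.Finite := by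
    refine ((hfin.image fun t => xi B (p + t • v)).preimage hinj.injOn).subset ?_
    rintro s ⟨hs, hmem⟩
    rw [hΓ] at hmem
    obtain ⟨t, htI, e⟩ := hmem
    exact ⟨t, ⟨htI, s, hs, e⟩, e⟩
  obtain ⟨M, hM⟩ := hfinS.bddAbove
  -- Beyond `S` the ray no longer meets the curve, so its tail lies in one unbounded chamber.
  set S := max M 0 + 1
  have hS0 : 0 < S := by positivity
  have hfree : ∀ s, S ≤ s → x + s • d ∈ (curve A B ε)ᶜ := by
    intro s hs hmem
    have h1 : s ≤ M := hM ⟨hS0.trans_le hs, hmem⟩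
    have h2 := le_max_left M 0
    linarith
  have hD : IsOuter (curve A B ε) (connectedComponentIn (curve A B ε)ᶜ (x + S • d)) := by
    refine ⟨⟨_, hfree S le_rfl, rfl⟩, not_isBounded_of_ray (x := x) hd (S := S) fun s hs => ?_⟩
    refine (isPreconnected_image_add_smul x d (ordConnected_Ici (a := S))
      ).subset_connectedComponentIn ⟨S, self_mem_Ici, rfl⟩ ?_ ⟨s, hs, rfl⟩
    rintro _ ⟨r, hr, rfl⟩
    exact hfree r hr
  have hpos : ∀ t ∈ Ioo a b, ∀ s ∈ Icc (0 : ℝ) 1, xi B (p + t • v) = x + s • S • d →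
      0 < s * S ∧ xi B (p + t • v) = x + (s * S) • d := by
    intro t htI s hs e
    rw [smul_smul] at e
    refine ⟨mul_pos (lt_of_le_of_ne hs.1 ?_) hS0, e⟩
    rintro rfl
    rw [zero_mul, zero_smul, add_zero] at e
    exact hC.subset_compl hx (hΓ ▸ ⟨t, htI, e⟩)
  refine (depth_le_encard_segment hF hP hfd (d := S • d) (smul_ne_zero hS0.ne' hd) hx hD
    (mem_connectedComponentIn (hfree S le_rfl)) ?_).trans (encard_le_encard ?_)
  · intro t htI s hs e
    obtain ⟨h1, h2⟩ := hpos t htI s hs e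
    obtain ⟨h3, h4⟩ := ht t htI _ h1 h2
    refine ⟨h3, ?_⟩
    rw [smul_dotProduct, smul_eq_mul]
    exact mul_ne_zero hS0.ne' h4
  · rintro t ⟨htI, s, hs, e⟩
    obtain ⟨h1, h2⟩ := hpos t htI s hs e
    exact ⟨htI, _, h1, h2⟩

/-- A chamber that meets a generic line of direction `d` has depth at most the number of
intersections of either half of that line. -/
theorem depth_le_encard_ray_of_generic (hB : IsGaleDual A B) (hε : ∀ i, ε i ≠ 0)
    (hF : IsFront a b (fun t => xi B (p + t • v)) h p v)
    (hP : params B ε = (fun t : ℝ => p + t • v) '' Ioo a b)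
    (hfd : ∀ t ∈ Ioo a b, fderiv ℝ (xi B) (p + t • v) v = h t • rot (p + t • v))
    {d : Fin 2 → ℝ} (hd : d ≠ 0) (hdt : ∀ t ∈ Ioo a b, h t ≠ 0 → d ⬝ᵥ (p + t • v) ≠ 0)
    (hlev : ∀ c, {t | t ∈ Ioo a b ∧ cross d (xi B (p + t • v)) = c}.Finite)
    {C : Set (Fin 2 → ℝ)} (hC : IsChamber (curve A B ε) C) {x : Fin 2 → ℝ} (hx : x ∈ C)
    (hgen : ∀ t ∈ Ioo a b, cross d (xi B (p + t • v)) = cross d x → h t ≠ 0)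
    {r : ℝ} (hr : r ≠ 0) :
    depth A B ε C ≤
      {t | t ∈ Ioo a b ∧ ∃ s > (0 : ℝ), xi B (p + t • v) = x + s • r • d}.encard := by
  have hline : ∀ t s : ℝ, xi B (p + t • v) = x + s • r • d →
      cross d (xi B (p + t • v)) = cross d x := by
    intro t s e
    rw [e, smul_smul, cross_add_smul]
  refine depth_le_encard_ray hB hε hF hP hfd hC (smul_ne_zero hr hd) hx
    ((hlev (cross d x)).subset ?_) ?_
  · rintro t ⟨ht, s, -, e⟩
    exact ⟨ht, hline t s e⟩
  · intro t ht s _ e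
    have h0 := hgen t ht (hline t s e)
    refine ⟨h0, ?_⟩
    rw [smul_dotProduct, smul_eq_mul]
    exact mul_ne_zero hr (hdt t ht h0)

/-- A point of the chamber cuts a generic line of the good direction into two rays sharing at most
`max m 1` hits; the ray with fewer hits gives the bound. -/
theorem depth_le_half (hB : IsGaleDual A B) (hε : ∀ i, ε i ≠ 0)
    (hF : IsFront a b (fun t => xi B (p + t • v)) h p v)
    (hP : params B ε = (fun t : ℝ => p + t • v) '' Ioo a b)
    (hfd : ∀ t ∈ Ioo a b, fderiv ℝ (xi B) (p + t • v) v = h t • rot (p + t • v)) {m : ℕ}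
    (hm : {t | t ∈ Ioo a b ∧ h t = 0}.encard = m) {C : Set (Fin 2 → ℝ)}
    (hC : IsChamber (curve A B ε) C) : depth A B ε C ≤ ((m / 2 : ℕ) : ℕ∞) := by
  obtain ⟨d, hd, hdt, hcount⟩ := hF.exists_direction hm
  have hZ : {t | t ∈ Ioo a b ∧ h t = 0}.Finite := Set.finite_of_encard_eq_coe hm
  have hlev : ∀ c, {t | t ∈ Ioo a b ∧ cross d (xi B (p + t • v)) = c}.Finite := fun c =>
    Set.finite_of_encard_le_coe (hcount c)
  have hΓ := curve_eq_image_Ioo (A := A) hB hε hP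
  obtain ⟨x₀, hx₀, hCeq⟩ := id hC
  obtain ⟨x, hx, hxZ⟩ := hF.exists_mem_component_cross_notMem hZ hd hlev
    (hZ.image fun t => cross d (xi B (p + t • v))) (hΓ ▸ hx₀)
  rw [← hΓ, ← hCeq] at hx
  have hgen : ∀ t ∈ Ioo a b, cross d (xi B (p + t • v)) = cross d x → h t ≠ 0 :=
    fun t ht e h0 => hxZ ⟨t, ⟨ht, h0⟩, e⟩
  have h1 := depth_le_encard_ray_of_generic hB hε hF hP hfd hd hdt hlev hC hx hgen
    one_ne_zero
  have h2 := depth_le_encard_ray_of_generic hB hε hF hP hfd hd hdt hlev hC hx hgen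
    (neg_ne_zero.mpr (one_ne_zero (α := ℝ)))
  set R₁ := {t | t ∈ Ioo a b ∧ ∃ s > (0 : ℝ), xi B (p + t • v) = x + s • (1 : ℝ) • d}
  set R₂ := {t | t ∈ Ioo a b ∧ ∃ s > (0 : ℝ), xi B (p + t • v) = x + s • (-1 : ℝ) • d}
  have hdisj : Disjoint R₁ R₂ := by
    rw [Set.disjoint_left]
    rintro t ⟨_, s, hs, e⟩ ⟨_, s', hs', e'⟩
    rw [smul_smul] at e e'
    have := smul_left_injective ℝ hd (add_left_cancel (e.symm.trans e'))
    linarith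
  have hsum : R₁.encard + R₂.encard ≤ ((max m 1 : ℕ) : ℕ∞) := by
    rw [← encard_union_eq hdisj]
    refine (encard_le_encard ?_).trans (hcount (cross d x))
    rintro t (⟨ht, s, -, e⟩ | ⟨ht, s, -, e⟩)
    · exact ⟨ht, by simp only [e, smul_smul, cross_add_smul]⟩
    · exact ⟨ht, by simp only [e, smul_smul, cross_add_smul]⟩
  have hf₁ : R₁.Finite := Set.finite_of_encard_le_coe (le_self_add.trans hsum)
  have hf₂ : R₂.Finite := Set.finite_of_encard_le_coe (le_add_self.trans hsum)
  rw [← hf₁.cast_ncard_eq] at h1 hsum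
  rw [← hf₂.cast_ncard_eq] at h2 hsum
  have hsum' : R₁.ncard + R₂.ncard ≤ max m 1 := by exact_mod_cast hsum
  -- For `m = 0` the total may still be 1, but the smaller of the two counts is then `0 = m / 2`.
  rcases le_total R₁.ncard R₂.ncard with hle | hle
  · exact h1.trans (by exact_mod_cast (by omega : R₁.ncard ≤ m / 2))
  · exact h2.trans (by exact_mod_cast (by omega : R₂.ncard ≤ m / 2))

/-- If both chambers had depth at least 2, a generic line across the shared arc would have two hits
on each outward ray and one on the arc: five, against a maximum of four. -/
theorem depth_eq_one_of_adjacent (hB : IsGaleDual A B) (hε : ∀ i, ε i ≠ 0)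
    (hF : IsFront a b (fun t => xi B (p + t • v)) h p v)
    (hP : params B ε = (fun t : ℝ => p + t • v) '' Ioo a b)
    (hfd : ∀ t ∈ Ioo a b, fderiv ℝ (xi B) (p + t • v) v = h t • rot (p + t • v))
    (hm : {t | t ∈ Ioo a b ∧ h t = 0}.encard = 4) {C D : Set (Fin 2 → ℝ)}
    (hC : IsChamber (curve A B ε) C) (hD : IsChamber (curve A B ε) D)
    (hdepth : depth A B ε C = 2) (hadj : Adjacent B ε C D) : depth A B ε D = 1 := by
  obtain ⟨d, hd, hdt, hcount⟩ := hF.exists_direction (m := 4) hm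
  have hZ : {t | t ∈ Ioo a b ∧ h t = 0}.Finite := Set.finite_of_encard_eq_coe (k := 4) hm
  have hlev : ∀ c, {t | t ∈ Ioo a b ∧ cross d (xi B (p + t • v)) = c}.Finite := fun c =>
    Set.finite_of_encard_le_coe (hcount c)
  have hΓ := curve_eq_image_Ioo (A := A) hB hε hP
  obtain ⟨Q, hQ, hproper⟩ := hF.exists_finite_ends hZ
  obtain ⟨hCD, V, hVo, ⟨l, hl⟩, hVc, hVf⟩ := hadj
  obtain ⟨r, hr, hrl⟩ := exists_smul_mem_params hε (hVc hl)
  rw [hP] at hrl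
  obtain ⟨t₁, ht₁, e₁⟩ := hrl
  simp only at e₁
  have hcones : ∀ t ∈ Ioo a b, p + t • v ∈ cone B ε := fun t ht =>
    (hP ▸ mem_image_of_mem _ ht : p + t • v ∈ params B ε).1
  -- Only countably many parameters are bad: lines through a cusp or a point of `Q`, and
  -- self-intersections. The factor `r⁻¹` undoes the normalization, as `V` need not be stable under
  -- scaling.
  obtain ⟨t₀, ⟨ht₀, ht₀V⟩, hgood⟩ : ∃ t₀ ∈ Ioo a b ∩ {t : ℝ | r⁻¹ • (p + t • v) ∈ V},
      t₀ ∉ (⋃ z ∈ {t | t ∈ Ioo a b ∧ h t = 0},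
          {t | t ∈ Ioo a b ∧ cross d (xi B (p + t • v)) = cross d (xi B (p + z • v))}) ∪
        (⋃ q ∈ Q, {t | t ∈ Ioo a b ∧ cross d (xi B (p + t • v)) = cross d q}) ∪
        {t | t ∈ Ioo a b ∧ h t ≠ 0 ∧ ∃ s ∈ Ioo a b, h s ≠ 0 ∧ s ≠ t ∧
          xi B (p + s • v) = xi B (p + t • v)} := by
    have hcount := (((hZ.biUnion fun z _ => hlev (cross d (xi B (p + z • v)))).countable.union
      (hQ.biUnion fun q _ => hlev (cross d q)).countable).union hF.countable_selfIntersections)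
    have hopen : IsOpen (Ioo a b ∩ {t : ℝ | r⁻¹ • (p + t • v) ∈ V}) :=
      isOpen_Ioo.inter (hVo.preimage (by fun_prop))
    obtain ⟨t, ht, hn⟩ := (hcount.dense_compl ℝ).inter_open_nonempty _ hopen
      ⟨t₁, ht₁, by rwa [mem_ofPred_eq, e₁, inv_smul_smul₀ hr.ne']⟩
    exact ⟨t, ht, hn⟩
  simp only [mem_union, mem_iUnion, not_or, not_exists, exists_prop, not_and] at hgood
  obtain ⟨⟨hg₁, hg₂⟩, hg₃⟩ := hgood
  have hgen : ∀ t ∈ Ioo a b, cross d (xi B (p + t • v)) = cross d (xi B (p + t₀ • v)) →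
      h t ≠ 0 := fun t ht e h0 => hg₁ t ⟨ht, h0⟩ ⟨ht₀, e.symm⟩
  have hself : ∀ t ∈ Ioo a b, xi B (p + t • v) = xi B (p + t₀ • v) → t = t₀ := by
    intro t ht e
    by_contra hne
    exact hg₃ ⟨ht₀, hgen t₀ ht₀ rfl, t, ht, hgen t ht (by rw [e]), hne, e⟩
  have hfront : xi B (p + t₀ • v) ∈ frontier C ∩ frontier D := by
    rw [← xi_smul hB hε (hcones t₀ ht₀) (inv_pos.mpr hr)]
    exact hVf ⟨_, ht₀V, rfl⟩
  obtain ⟨η, hη, hηC, hηD, honly⟩ := hF.exists_local_crossing hd ht₀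
    (mul_ne_zero (hgen t₀ ht₀ rfl) (hdt t₀ ht₀ (hgen t₀ ht₀ rfl)))
    (hproper _ fun hmem => hg₂ _ hmem ⟨ht₀, rfl⟩) hself (hΓ ▸ hC) (hΓ ▸ hD) hCD
    (frontier_subset_closure hfront.1) (frontier_subset_closure hfront.2)
  set y := xi B (p + t₀ • v) with hy
  have hinj : Function.Injective (fun s : ℝ => y + s • d) := fun s s' e =>
    smul_left_injective ℝ hd (add_left_cancel e)
  have hgenC : ∀ t ∈ Ioo a b, cross d (xi B (p + t • v)) = cross d (y + η • d) → h t ≠ 0 :=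
    fun t ht e => hgen t ht (by rw [e, cross_add_smul])
  have hgenD : ∀ t ∈ Ioo a b, cross d (xi B (p + t • v)) = cross d (y + (-η) • d) → h t ≠ 0 :=
    fun t ht e => hgen t ht (by rw [e, cross_add_smul])
  -- If `D` were outer, the short segment across the arc would leave `C` with a single crossing,
  -- contradicting depth 2.
  have hnout : ¬ IsOuter (curve A B ε) D := by
    intro hout
    have hline : ∀ t s : ℝ, xi B (p + t • v) = y + η • d + s • (-(2 * η)) • d →
        xi B (p + t • v) = y + (η - 2 * s * η) • d := by
      intro t s e
      rw [e]
      module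
    have hle := depth_le_encard_segment hF hP hfd (C := C) (x := y + η • d)
      (d := (-(2 * η)) • d)
      (smul_ne_zero (neg_ne_zero.mpr (mul_ne_zero two_ne_zero hη)) hd) hηC hout
      (by convert hηD using 1; module) ?_
    · have hsub : {t | t ∈ Ioo a b ∧ ∃ s ∈ Icc (0 : ℝ) 1,
          xi B (p + t • v) = y + η • d + s • (-(2 * η)) • d} ⊆ {t₀} := by
        rintro t ⟨ht, s, hs, e⟩
        refine honly t ht _ ?_ (hline t s e)
        rw [show η - 2 * s * η = (1 - 2 * s) * η by ring, abs_mul]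
        refine mul_le_of_le_one_left (abs_nonneg _) (abs_le.mpr ⟨?_, ?_⟩) <;>
          linarith [hs.1, hs.2]
      have := hle.trans (encard_le_encard hsub)
      rw [hdepth, encard_singleton] at this
      exact absurd this (by decide)
    · intro t ht s _ e
      have h0 := hgen t ht (by rw [hline t s e, cross_add_smul])
      refine ⟨h0, ?_⟩
      rw [smul_dotProduct, smul_eq_mul]
      exact mul_ne_zero (neg_ne_zero.mpr (mul_ne_zero two_ne_zero hη)) (hdt t ht h0)
  refine le_antisymm ?_ (one_le_depth hB hε hD hnout)
  by_contra hlt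
  have h2 : 2 ≤ depth A B ε D := Order.add_one_le_of_lt (not_le.mp hlt)
  have hCray := depth_le_encard_ray_of_generic hB hε hF hP hfd hd hdt hlev hC hηC hgenC hη
  have hDray := depth_le_encard_ray_of_generic hB hε hF hP hfd hd hdt hlev hD hηD hgenD
    (neg_ne_zero.mpr hη)
  -- The two rays start on opposite sides of `y` and point away from it, so their hits are distinct
  -- from each other and from `t₀`.
  set R₁ := {t | t ∈ Ioo a b ∧ ∃ s > (0 : ℝ), xi B (p + t • v) = y + η • d + s • η • d}
  set R₂ := {t | t ∈ Ioo a b ∧ ∃ s > (0 : ℝ),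
    xi B (p + t • v) = y + (-η) • d + s • (-η) • d}
  have hmem₁ : ∀ t ∈ R₁, t ∈ Ioo a b ∧ ∃ s > (0 : ℝ),
      xi B (p + t • v) = y + ((1 + s) * η) • d := by
    rintro t ⟨ht, s, hs, e⟩
    exact ⟨ht, s, hs, e.trans (by module)⟩
  have hmem₂ : ∀ t ∈ R₂, t ∈ Ioo a b ∧ ∃ s > (0 : ℝ),
      xi B (p + t • v) = y + (-(1 + s) * η) • d := by
    rintro t ⟨ht, s, hs, e⟩
    exact ⟨ht, s, hs, e.trans (by module)⟩
  have hdisj : Disjoint R₁ R₂ := by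
    rw [Set.disjoint_left]
    intro t h₁ h₂
    obtain ⟨_, s, hs, e⟩ := hmem₁ t h₁
    obtain ⟨_, s', hs', e'⟩ := hmem₂ t h₂
    have := mul_right_cancel₀ hη (hinj (e.symm.trans e'))
    linarith
  have hyd : xi B (p + t₀ • v) = y + ((0 : ℝ) * η) • d := by simp [hy]
  have hdisj' : Disjoint (R₁ ∪ R₂) {t₀} := by
    rw [Set.disjoint_singleton_right]
    rintro (h₁ | h₂)
    · obtain ⟨_, s, hs, e⟩ := hmem₁ _ h₁
      have := mul_right_cancel₀ hη (hinj (hyd.symm.trans e))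
      linarith
    · obtain ⟨_, s, hs, e⟩ := hmem₂ _ h₂
      have := mul_right_cancel₀ hη (hinj (hyd.symm.trans e))
      linarith
  have hsub : R₁ ∪ R₂ ∪ {t₀} ⊆ {t | t ∈ Ioo a b ∧ cross d (xi B (p + t • v)) = cross d y} := by
    rintro t ((h₁ | h₂) | rfl)
    · obtain ⟨ht, s, -, e⟩ := hmem₁ t h₁
      exact ⟨ht, by rw [e, cross_add_smul]⟩
    · obtain ⟨ht, s, -, e⟩ := hmem₂ t h₂
      exact ⟨ht, by rw [e, cross_add_smul]⟩
    · exact ⟨ht₀, rfl⟩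
  have hfive : (2 : ℕ∞) + 2 + 1 ≤ ((max 4 1 : ℕ) : ℕ∞) := by
    refine le_trans ?_ ((encard_le_encard hsub).trans (hcount _))
    rw [encard_union_eq hdisj', encard_union_eq hdisj, encard_singleton]
    gcongr
    · exact hdepth ▸ hCray
    · exact h2.trans hDray
  exact absurd hfive (by decide)

end Depth

end NearCircuit

/-! ### Assembly, with the empty cone treated apart. -/

theorem mainTheorem2 {n : ℕ} (A : Fin (n + 3) → Fin n → ℝ) (hA : NearCircuit.IsNearCircuit A)
    (B : Matrix (Fin (n + 3)) (Fin 2) ℝ) (hB : NearCircuit.IsGaleDual A B)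
    (ε : Fin (n + 3) → SignType) (hε : ∀ i, ε i ≠ 0)
    (m : ℕ) (hm : (NearCircuit.cusps B ε).encard = m) :
    (∀ C, NearCircuit.IsChamber (NearCircuit.curve A B ε) C →
      NearCircuit.depth A B ε C ≤ ((m / 2 : ℕ) : ℕ∞)) ∧
    (m = 2 ∨ m = 3 → ∀ C, NearCircuit.IsInner (NearCircuit.curve A B ε) C →
      NearCircuit.depth A B ε C = 1) ∧
    (m = 4 →
      (∀ C, NearCircuit.IsChamber (NearCircuit.curve A B ε) C →
        NearCircuit.depth A B ε C ≤ 2) ∧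
      (∀ C D, NearCircuit.IsChamber (NearCircuit.curve A B ε) C →
        NearCircuit.IsChamber (NearCircuit.curve A B ε) D →
        NearCircuit.depth A B ε C = 2 → NearCircuit.Adjacent B ε C D →
        NearCircuit.depth A B ε D = 1)) := by
  open NearCircuit in
  rcases (params B ε).eq_empty_or_nonempty with he | hne
  · have hm0 : m = 0 := by
      have : cusps B ε = ∅ := Set.eq_empty_of_forall_notMem fun l hl =>
        (he ▸ hl.1 : l ∈ (∅ : Set (Fin 2 → ℝ)))
      rw [this, Set.encard_empty] at hm
      exact_mod_cast hm.symm
    refine ⟨fun C hC => ?_, fun h => by omega, fun h => by omega⟩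
    rw [depth_eq_zero_of_isEmpty hB hε he hC]
    exact zero_le
  obtain ⟨a, b, h, p, v, hF, hP, hfd, hcusp⟩ := exists_isFront hB hε hne
  have hZ : {t | t ∈ Set.Ioo a b ∧ h t = 0}.encard = m := by
    have hinj : Function.Injective fun t : ℝ => p + t • v := fun s t e => by
      have := hF.cross_normal s t
      rw [show p + s • v = p + t • v from e] at this
      simp only [cross] at this
      linarith
    rw [← hm, ← hinj.encard_image]
    congr 1
    ext l
    simp only [cusps, hP, Set.mem_image, Set.mem_ofPred_eq]
    constructor
    · rintro ⟨t, ⟨ht, h0⟩, rfl⟩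
      exact ⟨⟨t, ht, rfl⟩, (hcusp t ht).mpr h0⟩
    · rintro ⟨⟨t, ht, rfl⟩, h0⟩
      exact ⟨t, ⟨ht, (hcusp t ht).mp h0⟩, rfl⟩
  have hhalf : ∀ C, IsChamber (curve A B ε) C → depth A B ε C ≤ ((m / 2 : ℕ) : ℕ∞) :=
    fun C hC => depth_le_half hB hε hF hP hfd hZ hC
  refine ⟨hhalf, fun hm' C hC => le_antisymm ?_ ?_, ?_⟩
  · have := hhalf C hC.1
    rwa [show m / 2 = 1 by omega, Nat.cast_one] at this
  · exact one_le_depth hB hε hC.1 fun hout => hout.2 hC.2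
  · rintro rfl
    exact ⟨hhalf, fun C D hC hD h2 hadj =>
      depth_eq_one_of_adjacent hB hε hF hP hfd hZ hC hD h2 hadj⟩
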